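/- For a finite undirected loopless graph $G=(V,E,w)$ with nonnegative edge weights (weight $1$ on every edge if $G$ is unweighted) let $L_G$ be its Laplacian (the diagonal matrix of weighted degrees minus the weighted adjacency matrix), let $L_G^{+}$ be the Moore–Penrose pseudo-inverse of $L_G$, and let $R_G(u,v)=(e_u-e_v)^{T}L_G^{+}(e_u-e_v)$ be the effective resistance between $u,v\in V$. Let $$\phi(G)=\min\Big\{\frac{w(S,V\setminus S)}{|S|}: S\subset V,\ 0<|S|\le |V|/2\Big\}$$ be the edge expansion, where $w(S,V\setminus S)$ is the total weight of the edges with exactly one endpoint in $S$. For $\epsilon\in(0,1)$, a $(1+\epsilon)$-resistance sparsifier of $G$ is a weighted graph $H$ on $V$, all of whose edges are edges of $G$ (with arbitrary new nonnegative weights), such that $(1-\epsilon)R_H(u,v)\le R_G(u,v)\le(1+\epsilon)R_H(u,v)$ for all $u,v\in V$. **Theorem.** There is an absolute constant $C>0$ such that for all $\beta,\gamma>0$ there is $n_0=n_0(\beta,\gamma)$ for which the following holds for every $n\ge n_0$ and every unweighted simple $D$-regular graph $G$ on $n$ vertices with $D\ge\beta n$ and $\phi(G)\ge\gamma D$. 1.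 For every real $\epsilon$ with $1/n^{0.99}<\epsilon<1$, $G$ has a $(1+\epsilon)$-resistance sparsifier with at most $\epsilon^{-1}\,n\,(\log n)^{C/(\beta\gamma^{2})}$ edges. 2. Such a sparsifier can be found in randomized polynomial time: there is a randomized algorithm, depending only on $\beta$ and $\gamma$, that on input $G$ and a rational number $\epsilon=p/q$ with $1/n^{0.99}<\epsilon<1$ always halts within a number of steps polynomial in the bit length of the input and, with probability at least $2/3$ over its coin tosses, outputs a $(1+\epsilon)$-resistance sparsifier of $G$ with rational edge weights and at most $\epsilon^{-1}\,n\,(\log n)^{C/(\beta\gamma^{2})}$ edges. -/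

import Mathlib

namespace ResSparse

/-! ### Weighted graphs, resistances, expansion -/

/-- A finite undirected loopless graph with nonnegative edge weights; a pair of weight `0` is a
non-edge. -/
@[ext]
structure WGraph (V : Type*) where
  w : V → V → ℝ
  symm : ∀ u v, w u v = w v u
  loopless : ∀ v, w v v = 0
  nonneg : ∀ u v, 0 ≤ w u v

/-- The Penrose conditions: `P` is the Moore-Penrose pseudo-inverse of the real matrix `A`. -/
structure IsMoorePenrose {V : Type*} [Fintype V] (A P : Matrix V V ℝ) : Prop where
  mul_mul_self : A * P * A = A
  self_mul_mul : P * A * P = P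
  symm_left : (A * P).IsSymm
  symm_right : (P * A).IsSymm

theorem IsMoorePenrose.unique {V : Type*} [Fintype V] {A P Q : Matrix V V ℝ}
    (hP : IsMoorePenrose A P) (hQ : IsMoorePenrose A Q) : P = Q := by
  have h1 : A * P = A * Q := by
    have e : (A * P) * (A * Q) = A * Q := by
      rw [← Matrix.mul_assoc, hP.mul_mul_self]
    have e' : (A * Q) * (A * P) = A * P := by
      rw [← Matrix.mul_assoc, hQ.mul_mul_self]
    have t := congrArg Matrix.transpose e
    rw [Matrix.transpose_mul, hP.symm_left.eq, hQ.symm_left.eq, e'] at t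
    exact t
  have h2 : P * A = Q * A := by
    have e : (P * A) * (Q * A) = P * A := by
      rw [Matrix.mul_assoc, ← Matrix.mul_assoc A, hQ.mul_mul_self]
    have e' : (Q * A) * (P * A) = Q * A := by
      rw [Matrix.mul_assoc, ← Matrix.mul_assoc A, hP.mul_mul_self]
    have t := congrArg Matrix.transpose e
    rw [Matrix.transpose_mul, hP.symm_right.eq, hQ.symm_right.eq, e'] at t
    exact t.symm
  calc P = P * A * P := hP.self_mul_mul.symm
    _ = Q * A * P := by rw [h2]
    _ = Q * (A * Q) := by rw [Matrix.mul_assoc, h1]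
    _ = Q := by rw [← Matrix.mul_assoc, hQ.self_mul_mul]

open scoped Matrix in
theorem exists_isMoorePenrose {V : Type*} [Fintype V] (A : Matrix V V ℝ)
    (hA : A.IsSymm) : ∃ P, IsMoorePenrose A P := by
  classical
  have hH : A.IsHermitian := by
    rw [Matrix.IsHermitian, Matrix.conjTranspose_eq_transpose_of_trivial]; exact hA
  set U : Matrix V V ℝ := (hH.eigenvectorUnitary : Matrix V V ℝ) with hU
  have hUU : Uᵀ * U = 1 := by
    have := Unitary.coe_star_mul_self hH.eigenvectorUnitary
    simpa [Matrix.star_eq_conjTranspose, Matrix.conjTranspose_eq_transpose_of_trivial] using this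
  set d := hH.eigenvalues
  have hAd : A = U * Matrix.diagonal d * Uᵀ := by
    have := hH.spectral_theorem
    rw [Unitary.conjStarAlgAut_apply] at this
    simpa [Matrix.star_eq_conjTranspose, Matrix.conjTranspose_eq_transpose_of_trivial,
      Function.comp_def] using this
  have key : ∀ a b : V → ℝ, (U * Matrix.diagonal a * Uᵀ) * (U * Matrix.diagonal b * Uᵀ)
      = U * Matrix.diagonal (fun i => a i * b i) * Uᵀ := by
    intro a b
    calc (U * Matrix.diagonal a * Uᵀ) * (U * Matrix.diagonal b * Uᵀ)
        = U * Matrix.diagonal a * (Uᵀ * U) * Matrix.diagonal b * Uᵀ := by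
          simp only [Matrix.mul_assoc]
      _ = _ := by
          rw [hUU, Matrix.mul_one, Matrix.mul_assoc U, Matrix.diagonal_mul_diagonal]
  have ksymm : ∀ a : V → ℝ, (U * Matrix.diagonal a * Uᵀ).IsSymm := by
    intro a
    simp [Matrix.IsSymm, Matrix.transpose_mul, Matrix.mul_assoc]
  refine ⟨U * Matrix.diagonal (fun i => (d i)⁻¹) * Uᵀ, ?_, ?_, ?_, ?_⟩
  · rw [hAd, key, key]
    congr 3
    funext i
    exact mul_inv_mul_cancel (d i)
  · rw [hAd, key, key]
    congr 3
    funext i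
    by_cases h : d i = 0 <;> simp [h]
  · rw [hAd, key]; exact ksymm _
  · rw [hAd, key]; exact ksymm _

open Classical in
/-- The Moore-Penrose pseudo-inverse. It exists for every symmetric matrix
(`exists_isMoorePenrose`), and only such matrices are used here. -/
noncomputable def pinv {V : Type*} [Fintype V] (A : Matrix V V ℝ) : Matrix V V ℝ :=
  if h : ∃ P, IsMoorePenrose A P then h.choose else 0

theorem pinv_spec {V : Type*} [Fintype V] (A : Matrix V V ℝ) (hA : A.IsSymm) :
    IsMoorePenrose A (pinv A) := by
  have h := exists_isMoorePenrose A hA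
  rw [pinv, dif_pos h]
  exact h.choose_spec

namespace WGraph

variable {V : Type*}

/-- The underlying simple graph: the pairs that carry a nonzero weight. -/
def support (G : WGraph V) : SimpleGraph V where
  Adj u v := G.w u v ≠ 0
  symm := ⟨fun u v h => by rwa [G.symm v u]⟩
  loopless := ⟨fun v h => h (G.loopless v)⟩

/-- The number of edges. -/
noncomputable def numEdges (G : WGraph V) : ℕ := G.support.edgeSet.ncard

/-- An unweighted graph, all of whose edges have weight `1`. -/
def ofGraph (G : SimpleGraph V) [DecidableRel G.Adj] : WGraph V where
  w u v := if G.Adj u v then 1 else 0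
  symm u v := by simp [G.adj_comm]
  loopless v := by simp
  nonneg u v := by split_ifs <;> norm_num

variable [Fintype V]

/-- The weighted degree. -/
def wdeg (G : WGraph V) (v : V) : ℝ := ∑ u, G.w v u

/-- The Laplacian: the diagonal matrix of weighted degrees minus the weighted adjacency matrix. -/
def laplacian [DecidableEq V] (G : WGraph V) : Matrix V V ℝ :=
  Matrix.diagonal G.wdeg - Matrix.of G.w

theorem laplacian_isSymm [DecidableEq V] (G : WGraph V) : G.laplacian.IsSymm := by
  rw [laplacian]
  refine Matrix.IsSymm.sub (Matrix.isSymm_diagonal _) ?_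
  ext u v
  exact G.symm v u

/-- The effective resistance `(e_u - e_v)ᵀ L⁺ (e_u - e_v)`. -/
noncomputable def resistance [DecidableEq V] (G : WGraph V) (u v : V) : ℝ :=
  (Pi.single u 1 - Pi.single v 1 : V → ℝ) ⬝ᵥ
    (pinv G.laplacian).mulVec (Pi.single u 1 - Pi.single v 1)

/-- The total weight of the edges with exactly one endpoint in `S`. -/
def cut [DecidableEq V] (G : WGraph V) (S : Finset V) : ℝ :=
  ∑ u ∈ S, ∑ v ∈ Sᶜ, G.w u v

/-- The edge expansion: the minimum of `w(S, Sᶜ) / |S|` over all `S` with `0 < |S| ≤ |V| / 2`. -/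
noncomputable def expansion [DecidableEq V] (G : WGraph V) : ℝ :=
  ⨅ S : {S : Finset V // 0 < S.card ∧ 2 * S.card ≤ Fintype.card V},
    G.cut S.1 / (S.1.card : ℝ)

/-- `H` is a `(1+ε)`-resistance sparsifier of `G`: a reweighted subgraph that preserves all
effective resistances. -/
def IsResistanceSparsifier [DecidableEq V] (G H : WGraph V) (ε : ℝ) : Prop :=
  H.support ≤ G.support ∧
    ∀ u v, (1 - ε) * H.resistance u v ≤ G.resistance u v ∧
      G.resistance u v ≤ (1 + ε) * H.resistance u v

end WGraph

/-! ### A randomized random-access machine -/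

/-- The memory: arrays `a = 0, 1, 2, …` of natural numbers, each with two indices, so that
`m a i j` is the content of cell `(i, j)` of array `a`. -/
abbrev Memory := ℕ → ℕ → ℕ → ℕ

/-- Expressions: constants, memory cells (with computed indices), addition, and truncated
subtraction. There is no multiplication, so in `t` steps numbers grow by `O(t)` bits only, and the
unit-cost measure below agrees with Turing machine time up to a polynomial. -/
inductive Expr where
  | const (k : ℕ) : Expr
  | read (a : ℕ) (i j : Expr) : Expr
  | add (e f : Expr) : Expr
  | sub (e f : Expr) : Expr

/-- The value of an expression. -/
def Expr.eval (m : Memory) : Expr → ℕ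
  | .const k => k
  | .read a i j => m a (i.eval m) (j.eval m)
  | .add e f => e.eval m + f.eval m
  | .sub e f => e.eval m - f.eval m

/-- Programs. -/
inductive Prog where
  | skip : Prog
  /-- Write the value of `e` into cell `(i, j)` of array `a`. -/
  | assign (a : ℕ) (i j e : Expr) : Prog
  /-- Toss a fair coin and write the outcome, `0` or `1`, into cell `(i, j)` of array `a`. -/
  | toss (a : ℕ) (i j : Expr) : Prog
  | seq (p q : Prog) : Prog
  /-- Run `p` if `c` is nonzero and `q` otherwise. -/
  | ite (c : Expr) (p q : Prog) : Prog
  /-- Run `p` as long as `c` is nonzero. -/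
  | loop (c : Expr) (p : Prog) : Prog

/-- A state of a computation: the memory and the number of coins tossed so far. -/
structure State where
  mem : Memory
  pos : ℕ

/-- Overwrite one cell. -/
def Memory.write (m : Memory) (a i j x : ℕ) : Memory :=
  fun a' i' j' => if a' = a ∧ i' = i ∧ j' = j then x else m a' i' j'

/-- `Exec ω p s t s'`: with coin outcomes `ω`, the program `p` started in `s` halts after `t` steps
in `s'`. Every elementary command and every evaluation of a branching condition is one step. -/
inductive Exec (ω : ℕ → Bool) : Prog → State → ℕ → State → Prop
  | skip (s : State) : Exec ω .skip s 1 s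
  | assign (a : ℕ) (i j e : Expr) (s : State) :
      Exec ω (.assign a i j e) s 1
        ⟨s.mem.write a (i.eval s.mem) (j.eval s.mem) (e.eval s.mem), s.pos⟩
  | toss (a : ℕ) (i j : Expr) (s : State) :
      Exec ω (.toss a i j) s 1
        ⟨s.mem.write a (i.eval s.mem) (j.eval s.mem) (if ω s.pos then 1 else 0), s.pos + 1⟩
  | seq {p q : Prog} {s s' s'' : State} {t t' : ℕ} :
      Exec ω p s t s' → Exec ω q s' t' s'' → Exec ω (.seq p q) s (t + t') s''
  | ite_pos {c : Expr} {p q : Prog} {s s' : State} {t : ℕ} :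
      c.eval s.mem ≠ 0 → Exec ω p s t s' → Exec ω (.ite c p q) s (t + 1) s'
  | ite_neg {c : Expr} {p q : Prog} {s s' : State} {t : ℕ} :
      c.eval s.mem = 0 → Exec ω q s t s' → Exec ω (.ite c p q) s (t + 1) s'
  | loop_done {c : Expr} {p : Prog} {s : State} :
      c.eval s.mem = 0 → Exec ω (.loop c p) s 1 s
  | loop_step {c : Expr} {p : Prog} {s s' s'' : State} {t t' : ℕ} :
      c.eval s.mem ≠ 0 → Exec ω p s t s' → Exec ω (.loop c p) s' t' s'' →
      Exec ω (.loop c p) s (t + t' + 1) s''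

/-- The computation is determined by the program, the initial state and the coins. -/
theorem Exec.deterministic {ω : ℕ → Bool} {p : Prog} {s s₁ s₂ : State} {t₁ t₂ : ℕ}
    (h₁ : Exec ω p s t₁ s₁) (h₂ : Exec ω p s t₂ s₂) : t₁ = t₂ ∧ s₁ = s₂ := by
  induction h₁ generalizing t₂ s₂ with
  | skip s => cases h₂; exact ⟨rfl, rfl⟩
  | assign a i j e s => cases h₂; exact ⟨rfl, rfl⟩
  | toss a i j s => cases h₂; exact ⟨rfl, rfl⟩
  | seq _ _ ih ih' =>
    cases h₂ with
    | seq g g' =>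
      obtain ⟨rfl, rfl⟩ := ih g
      obtain ⟨rfl, rfl⟩ := ih' g'
      exact ⟨rfl, rfl⟩
  | ite_pos hc _ ih =>
    cases h₂ with
    | ite_pos _ g => obtain ⟨rfl, rfl⟩ := ih g; exact ⟨rfl, rfl⟩
    | ite_neg hc' _ => exact absurd hc' hc
  | ite_neg hc _ ih =>
    cases h₂ with
    | ite_pos hc' _ => exact absurd hc hc'
    | ite_neg _ g => obtain ⟨rfl, rfl⟩ := ih g; exact ⟨rfl, rfl⟩
  | loop_done hc =>
    cases h₂ with
    | loop_done _ => exact ⟨rfl, rfl⟩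
    | loop_step hc' _ _ => exact absurd hc hc'
  | loop_step hc _ _ ih ih' =>
    cases h₂ with
    | loop_done hc' => exact absurd hc' hc
    | loop_step _ g g' =>
      obtain ⟨rfl, rfl⟩ := ih g
      obtain ⟨rfl, rfl⟩ := ih' g'
      exact ⟨rfl, rfl⟩

/-- A finite list of coin outcomes, continued by `false`. -/
def extendCoins {T : ℕ} (r : Fin T → Bool) : ℕ → Bool :=
  fun k => if h : k < T then r ⟨k, h⟩ else false

open Classical in
/-- Started on the memory `m`, the program `A` halts within `T` steps whatever the coins are, and
with probability at least `2/3` over `T` independent fair coins (it cannot toss more than that)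
its final memory satisfies `Good`. -/
def SolvesInTime (A : Prog) (m : Memory) (T : ℕ) (Good : Memory → Prop) : Prop :=
  (∀ ω : ℕ → Bool, ∃ t ≤ T, ∃ s, Exec ω A ⟨m, 0⟩ t s) ∧
  (2 / 3 : ℝ) * 2 ^ T ≤
    ((Finset.univ.filter fun r : Fin T → Bool =>
      ∃ t s, Exec (extendCoins r) A ⟨m, 0⟩ t s ∧ Good s.mem).card : ℝ)

/-- The input of a graph `G` on `n` vertices and the rational number `p / q`: array `0` holds
`n, p, q` in its cells `(0,0), (0,1), (0,2)`, array `1` holds the adjacency matrix of `G`, and all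
other cells are `0`. -/
def inputMemory {n : ℕ} (G : SimpleGraph (Fin n)) [DecidableRel G.Adj] (p q : ℕ) : Memory :=
  fun a i j =>
    if a = 0 ∧ i = 0 ∧ j = 0 then n
    else if a = 0 ∧ i = 0 ∧ j = 1 then p
    else if a = 0 ∧ i = 0 ∧ j = 2 then q
    else if h : a = 1 ∧ i < n ∧ j < n then
      if G.Adj ⟨i, h.2.1⟩ ⟨j, h.2.2⟩ then 1 else 0
    else 0

/-- The length of the input in bits. -/
def inputSize (n p q : ℕ) : ℕ := n ^ 2 + Nat.size n + Nat.size p + Nat.size q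

/-- The memory describes the weighted graph `H` with rational weights: the numerators stand in
array `2`, and cell `(0,0)` of array `3` holds the positive common denominator. -/
def IsOutput {n : ℕ} (m : Memory) (H : WGraph (Fin n)) : Prop :=
  0 < m 3 0 0 ∧ ∀ i j : Fin n, H.w i j = (m 2 i j : ℝ) / (m 3 0 0 : ℝ)

end ResSparse

/-! In a dense regular expander the resistances carry almost no information: all of them are close
to `2 / D`. To see this, write `e_u - e_v = L h + p`, where `h` is `1 / deg u` at `u` and `-1 / deg
v` at `v`, and `p` is the difference of the random-walk rows of `u` and `v`. Correcting `h` by a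
solution `y` of `L y = p` gives `R(u,v) = 1 / deg u + 1 / deg v`, up to a direct-edge term and the
energy of `y`. A spectral gap `l` bounds that energy by `‖p‖² / l`, and `‖p‖²` is `O(W / D)` if the
weights are at most `W`. Cheeger's inequality supplies a gap of order `γ² D`
(`exists_resistance_eq`, `Expands.hasGap`, `abs_resistance_sub_le`). So it suffices to find a sparse
reweighted subgraph that expands, has bounded weights, and has all weighted degrees within a factor
`1 + O(ε)` of `D`.

Keeping every edge with probability `1 / K` and weight `K` leaves expected degree `d = D / K`, but
the degrees `δ` then fluctuate by a relative `√(log n / d)`, which would force `d` to be of order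
`ε⁻²`. The remedy is to give a kept edge `uv` the weight `K (1 + (d - δ_u) / d + (d - δ_v) / d)`,
the linearization of `K d² / (δ_u δ_v)`. In the weighted degree of `v` the first-order deviation of
`δ_v` cancels. There remain `(δ_v - d)² / d` and the total deviation of the degrees of the
neighbours of `v`, divided by `d`. Given the edges at `v`, the latter is a sum over the other,
independent edges and concentrates, so the relative error is only `O(log n / d)` and `d` of order
`ε⁻¹ log² n` suffices (`IsGood`, `le_count_isGood`, `IsGood.abs_wdeg_sub_le`). Cuts survive by a
Chernoff bound whose exponent grows with the size of the set, which pays for the union over all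
sets.

The algorithm does exactly this with `K = 2 ^ k`, keeping an edge when `k` coins all show `1`.
Products are computed by repeated addition, with repetition counts polynomial in `n`; the coins
affect which edges survive but not the time bound. -/

namespace ResSparse

open Finset Matrix

/-! ### Resistances from a spectral gap. -/

namespace WGraph

variable {V : Type*} [Fintype V]

/-- The Dirichlet energy of a potential. -/
noncomputable def energy (G : WGraph V) (x : V → ℝ) : ℝ :=
  (∑ u, ∑ v, G.w u v * (x u - x v) ^ 2) / 2

/-- Every nonzero eigenvalue of the Laplacian is at least `l`, in variational form. -/
def HasGap (G : WGraph V) (l : ℝ) : Prop :=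
  ∀ f : V → ℝ, ∑ u, f u = 0 → l * ∑ u, f u ^ 2 ≤ G.energy f

theorem energy_nonneg (G : WGraph V) (x : V → ℝ) : 0 ≤ G.energy x := by
  unfold energy
  have : 0 ≤ ∑ u, ∑ v, G.w u v * (x u - x v) ^ 2 :=
    sum_nonneg fun u _ => sum_nonneg fun v _ => mul_nonneg (G.nonneg u v) (sq_nonneg _)
  linarith

theorem energy_sub_const (G : WGraph V) (x : V → ℝ) (c : ℝ) :
    G.energy (fun u => x u - c) = G.energy x := by
  simp [energy]

theorem sum_sum_w_mul_comm (G : WGraph V) (F : V → V → ℝ) :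
    ∑ u, ∑ v, G.w u v * F u v = ∑ u, ∑ v, G.w u v * F v u := by
  rw [sum_comm]
  refine sum_congr rfl fun u _ => sum_congr rfl fun v _ => ?_
  rw [G.symm]

/-- The entries of a random-walk row sum to `1` and are at most `W / deg`, so the squared norm of a
row is at most `W / deg ≤ 2 * W / D`; the difference of two rows costs a factor `4`. -/
theorem sum_sq_div_sub_div_le (G : WGraph V) {D W : ℝ} (hD : 0 < D)
    (hdeg : ∀ u, D / 2 ≤ G.wdeg u) (hW : ∀ u v, G.w u v ≤ W) (u v : V) :
    ∑ z, (G.w u z / G.wdeg u - G.w v z / G.wdeg v) ^ 2 ≤ 8 * W / D := by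
  have hpos : ∀ u, 0 < G.wdeg u := fun u => lt_of_lt_of_le (by positivity) (hdeg u)
  have hW0 : 0 ≤ W := (G.nonneg u v).trans (hW u v)
  have h1 : ∀ a, ∑ z, (G.w a z / G.wdeg a) ^ 2 ≤ 2 * W / D := by
    intro a
    calc ∑ z, (G.w a z / G.wdeg a) ^ 2 ≤ ∑ z, W / G.wdeg a ^ 2 * G.w a z := by
          refine sum_le_sum fun z _ => ?_
          rw [div_pow, div_mul_eq_mul_div]
          refine div_le_div_of_nonneg_right ?_ (by positivity)
          rw [sq]
          exact mul_le_mul_of_nonneg_right (hW a z) (G.nonneg a z)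
      _ = W / G.wdeg a := by
          rw [← mul_sum]
          change W / G.wdeg a ^ 2 * G.wdeg a = _
          have := (hpos a).ne'
          field_simp
      _ ≤ W / (D / 2) := div_le_div_of_nonneg_left hW0 (by positivity) (hdeg a)
      _ = 2 * W / D := by field_simp
  calc ∑ z, (G.w u z / G.wdeg u - G.w v z / G.wdeg v) ^ 2
      ≤ ∑ z, (2 * (G.w u z / G.wdeg u) ^ 2 + 2 * (G.w v z / G.wdeg v) ^ 2) :=
        sum_le_sum fun z _ => by nlinarith [sq_nonneg (G.w u z / G.wdeg u + G.w v z / G.wdeg v)]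
    _ = 2 * ∑ z, (G.w u z / G.wdeg u) ^ 2 + 2 * ∑ z, (G.w v z / G.wdeg v) ^ 2 := by
        rw [sum_add_distrib, mul_sum, mul_sum]
    _ ≤ 2 * (2 * W / D) + 2 * (2 * W / D) := by gcongr <;> exact h1 _
    _ = 8 * W / D := by ring

variable [DecidableEq V]

theorem laplacian_mulVec (G : WGraph V) (x : V → ℝ) (u : V) :
    (G.laplacian *ᵥ x) u = ∑ v, G.w u v * (x u - x v) := by
  rw [laplacian, Matrix.sub_mulVec, Pi.sub_apply, Matrix.mulVec_diagonal]
  simp only [mul_sub, sum_sub_distrib, wdeg, sum_mul]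
  rfl

theorem dotProduct_laplacian_mulVec (G : WGraph V) (x : V → ℝ) :
    x ⬝ᵥ G.laplacian *ᵥ x = G.energy x := by
  have h1 : x ⬝ᵥ G.laplacian *ᵥ x = ∑ u, ∑ v, G.w u v * (x u * (x u - x v)) := by
    simp only [dotProduct, laplacian_mulVec, mul_sum]
    exact sum_congr rfl fun u _ => sum_congr rfl fun v _ => by ring
  have h2 := G.sum_sum_w_mul_comm fun u v => x u * (x u - x v)
  have h3 : ∑ u, ∑ v, G.w u v * (x u - x v) ^ 2 =
      ∑ u, ∑ v, G.w u v * (x u * (x u - x v)) + ∑ u, ∑ v, G.w u v * (x v * (x v - x u)) := by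
    simp only [← sum_add_distrib]
    exact sum_congr rfl fun u _ => sum_congr rfl fun v _ => by ring
  rw [h1, energy, h3, ← h2]
  ring

theorem laplacian_dotProduct_comm (G : WGraph V) (x y : V → ℝ) :
    (G.laplacian *ᵥ x) ⬝ᵥ y = x ⬝ᵥ (G.laplacian *ᵥ y) := by
  rw [dotProduct_comm, dotProduct_mulVec, ← mulVec_transpose, G.laplacian_isSymm.eq,
    dotProduct_comm]

theorem sum_laplacian_mulVec (G : WGraph V) (x : V → ℝ) : ∑ u, (G.laplacian *ᵥ x) u = 0 := by
  have h := G.laplacian_dotProduct_comm x (fun _ => 1)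
  have h0 : G.laplacian *ᵥ (fun _ => (1 : ℝ)) = 0 := by
    ext u; simp [laplacian_mulVec]
  rw [h0] at h
  simpa [dotProduct] using h

/-- `L P` is the orthogonal projection onto the range of `L`, so the residual of `P b` lies in the
kernel of `L`. It also has zero sum, and the gap leaves only zero there. -/
theorem exists_laplacian_mulVec_eq (G : WGraph V) {l : ℝ} (hl : 0 < l) (hG : G.HasGap l)
    (b : V → ℝ) (hb : ∑ u, b u = 0) : ∃ x, G.laplacian *ᵥ x = b := by
  have hP := pinv_spec _ G.laplacian_isSymm
  set L := G.laplacian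
  set P := pinv L
  refine ⟨P *ᵥ b, ?_⟩
  have hLLP : L * (L * P) = L := by
    have e := congrArg transpose hP.mul_mul_self
    have e2 := hP.symm_left.eq
    rw [transpose_mul, e2, G.laplacian_isSymm.eq] at e
    exact e
  set r : V → ℝ := b - L *ᵥ (P *ᵥ b) with hr
  have hLr : L *ᵥ r = 0 := by
    rw [hr, mulVec_sub, mulVec_mulVec, mulVec_mulVec, Matrix.mul_assoc, hLLP, sub_self]
  have hsum : ∑ u, r u = 0 := by
    simp only [hr, Pi.sub_apply, sum_sub_distrib, hb]
    rw [G.sum_laplacian_mulVec, sub_zero]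
  have hE : G.energy r = 0 := by
    rw [← G.dotProduct_laplacian_mulVec]
    change r ⬝ᵥ L *ᵥ r = 0
    rw [hLr, dotProduct_zero]
  have h := hG r hsum
  rw [hE] at h
  have hz : ∑ u, r u ^ 2 = 0 :=
    le_antisymm (by nlinarith [sum_nonneg fun u (_ : u ∈ univ) => sq_nonneg (r u)])
      (sum_nonneg fun u _ => sq_nonneg _)
  have hr0 : r = 0 := by
    ext u
    have := (sum_eq_zero_iff_of_nonneg fun u _ => sq_nonneg (r u)).1 hz u (mem_univ u)
    simpa using this
  exact (sub_eq_zero.1 hr0).symm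

/-- Since `L P L = L`, any solution of the Poisson equation may replace the one given by the
pseudo-inverse. -/
theorem resistance_eq_of_laplacian_mulVec (G : WGraph V) {u v : V} {x : V → ℝ}
    (hx : G.laplacian *ᵥ x = Pi.single u 1 - Pi.single v 1) :
    G.resistance u v = x u - x v := by
  have hP := pinv_spec _ G.laplacian_isSymm
  rw [resistance, ← hx, mulVec_mulVec, G.laplacian_dotProduct_comm, mulVec_mulVec,
    ← Matrix.mul_assoc, hP.mul_mul_self, hx, dotProduct_sub, dotProduct_single,
    dotProduct_single]
  simp

theorem resistance_self (G : WGraph V) (u : V) : G.resistance u u = 0 := by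
  simp [resistance]

theorem laplacian_mulVec_single (G : WGraph V) (u v : V) (c : ℝ) :
    (G.laplacian *ᵥ Pi.single u c) v = c * (G.wdeg u * (Pi.single u 1 : V → ℝ) v - G.w u v) := by
  rw [laplacian_mulVec]
  simp only [mul_sub, sum_sub_distrib]
  have h1 : ∑ x, G.w v x * (Pi.single u c : V → ℝ) x = G.w v u * c := by
    simp [Pi.single_apply]
  rw [h1, ← sum_mul, G.symm v u]
  by_cases h : v = u
  · subst h; simp [wdeg, G.loopless]; ring
  · simp [h]; ring

/-- The effective resistance is the sum of the inverse degrees, up to an explicit error term. -/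
theorem exists_resistance_eq (G : WGraph V) {l : ℝ} (hl : 0 < l) (hG : G.HasGap l)
    {u v : V} (huv : u ≠ v) (hu : 0 < G.wdeg u) (hv : 0 < G.wdeg v) :
    ∃ e : ℝ, 0 ≤ e ∧ l * e ≤ ∑ z, (G.w u z / G.wdeg u - G.w v z / G.wdeg v) ^ 2 ∧
      G.resistance u v =
        1 / G.wdeg u + 1 / G.wdeg v - 2 * G.w u v / (G.wdeg u * G.wdeg v) + e := by
  set p : V → ℝ := fun z => G.w u z / G.wdeg u - G.w v z / G.wdeg v with hp
  have hps : ∑ z, p z = 0 := by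
    simp only [hp, sum_sub_distrib, ← sum_div]
    change G.wdeg u / G.wdeg u - G.wdeg v / G.wdeg v = 0
    rw [div_self hu.ne', div_self hv.ne', sub_self]
  obtain ⟨y, hy⟩ := G.exists_laplacian_mulVec_eq hl hG p hps
  -- The diagonal part of the Laplacian is inverted exactly; the off-diagonal part leaves the defect
  -- `p`, which `y` corrects.
  set h : V → ℝ := Pi.single u (1 / G.wdeg u) - Pi.single v (1 / G.wdeg v) with hh
  have hLh : G.laplacian *ᵥ h = Pi.single u 1 - Pi.single v 1 - p := by
    ext z
    rw [hh, mulVec_sub, Pi.sub_apply, laplacian_mulVec_single, laplacian_mulVec_single]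
    simp only [hp, Pi.sub_apply]
    field_simp
    ring
  have hLx : G.laplacian *ᵥ (h + y) = Pi.single u 1 - Pi.single v 1 := by
    rw [mulVec_add, hLh, hy, sub_add_cancel]
  -- Pair `L h = e_u - e_v - p` with `y` and move `L` across by symmetry; `p ⬝ᵥ y` is the energy,
  -- and `h ⬝ᵥ p` will be the direct-edge term.
  have hyuv : y u - y v = h ⬝ᵥ p + G.energy y := by
    rw [← G.dotProduct_laplacian_mulVec, hy]
    have e1 := G.laplacian_dotProduct_comm h y
    rw [hLh, hy, sub_dotProduct, sub_dotProduct, single_dotProduct, single_dotProduct] at e1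
    rw [← e1, dotProduct_comm y p]
    ring
  have hhp : h ⬝ᵥ p = -(2 * G.w u v / (G.wdeg u * G.wdeg v)) := by
    rw [hh, sub_dotProduct, single_dotProduct, single_dotProduct]
    simp only [hp, G.loopless, G.symm v u]
    field_simp
    ring
  refine ⟨G.energy y, G.energy_nonneg y, ?_, ?_⟩
  -- Centring `y` makes the gap applicable. With `E` the energy, Cauchy–Schwarz gives `E² ≤ ‖p‖² ‖y
  -- - m‖² ≤ ‖p‖² E / l`, and `E` is cancelled when it is positive.
  · set m : ℝ := (∑ z, y z) / Fintype.card V with hm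
    have hcard : (Fintype.card V : ℝ) ≠ 0 := by
      have : 0 < Fintype.card V := Fintype.card_pos_iff.2 ⟨u⟩
      positivity
    have hy0 : ∑ z, (y z - m) = 0 := by
      rw [sum_sub_distrib, sum_const, nsmul_eq_mul, card_univ, hm]
      field_simp
      ring
    have hgap := hG (fun z => y z - m) hy0
    rw [energy_sub_const] at hgap
    have hE : G.energy y = ∑ z, p z * (y z - m) := by
      rw [← G.dotProduct_laplacian_mulVec, hy]
      simp only [mul_sub, sum_sub_distrib, ← sum_mul, hps, dotProduct]
      simp [mul_comm]
    have hcs := sum_mul_sq_le_sq_mul_sq univ p (fun z => y z - m)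
    rw [← hE] at hcs
    rcases (G.energy_nonneg y).eq_or_lt with h0 | h0
    · rw [← h0, mul_zero]
      exact sum_nonneg fun z _ => sq_nonneg _
    · have hPn : 0 ≤ ∑ z, p z ^ 2 := sum_nonneg fun z _ => sq_nonneg _
      have h3 : l * G.energy y ^ 2 ≤ (∑ z, p z ^ 2) * G.energy y := by
        calc l * G.energy y ^ 2 ≤ l * ((∑ z, p z ^ 2) * ∑ z, (y z - m) ^ 2) :=
              mul_le_mul_of_nonneg_left hcs hl.le
          _ = (∑ z, p z ^ 2) * (l * ∑ z, (y z - m) ^ 2) := by ring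
          _ ≤ _ := mul_le_mul_of_nonneg_left hgap hPn
      refine le_of_mul_le_mul_right ?_ h0
      calc l * G.energy y * G.energy y = l * G.energy y ^ 2 := by ring
        _ ≤ _ := h3
  · rw [G.resistance_eq_of_laplacian_mulVec hLx]
    have : (h + y) u - (h + y) v = h u - h v + (y u - y v) := by
      simp only [Pi.add_apply]; ring
    rw [this, hyuv, hhp, hh]
    simp [huv, huv.symm]
    ring

/-! ### Cheeger's inequality -/

/-- Every set of at most half of the vertices has a boundary of weight at least `φ` times
its size. -/
def Expands (G : WGraph V) (φ : ℝ) : Prop :=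
  ∀ S : Finset V, 0 < S.card → 2 * S.card ≤ Fintype.card V → φ * S.card ≤ G.cut S

theorem cut_eq_sum_abs (G : WGraph V) (S : Finset V) :
    G.cut S = (∑ u, ∑ v, G.w u v *
      |(if u ∈ S then (1 : ℝ) else 0) - (if v ∈ S then 1 else 0)|) / 2 := by
  have h1 : G.cut S = ∑ u, ∑ v, G.w u v * (if u ∈ S ∧ v ∉ S then (1 : ℝ) else 0) := by
    rw [cut, ← sum_filter_add_sum_filter_not univ (fun u => u ∈ S), filter_mem_eq_inter,
      univ_inter]
    rw [sum_eq_zero (s := univ.filter fun u => u ∉ S), add_zero]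
    · refine sum_congr rfl fun u hu => ?_
      rw [← sum_filter_add_sum_filter_not univ (fun v => v ∈ S), filter_mem_eq_inter,
        univ_inter, sum_eq_zero (s := S), zero_add]
      · refine sum_congr (by ext; simp) fun v hv => ?_
        simp only [mem_filter, mem_univ, true_and] at hv
        simp [hu, hv]
      · intro v hv; simp [hv]
    · intro u hu
      simp only [mem_filter, mem_univ, true_and] at hu
      exact sum_eq_zero fun v _ => by simp [hu]
  have h2 := G.sum_sum_w_mul_comm fun u v => (if u ∈ S ∧ v ∉ S then (1 : ℝ) else 0)
  have h3 : ∑ u, ∑ v, G.w u v * |(if u ∈ S then (1 : ℝ) else 0) - (if v ∈ S then 1 else 0)| =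
      ∑ u, ∑ v, G.w u v * (if u ∈ S ∧ v ∉ S then (1 : ℝ) else 0) +
      ∑ u, ∑ v, G.w u v * (if v ∈ S ∧ u ∉ S then (1 : ℝ) else 0) := by
    simp only [← sum_add_distrib]
    refine sum_congr rfl fun u _ => sum_congr rfl fun v _ => ?_
    by_cases hu : u ∈ S <;> by_cases hv : v ∈ S <;> simp [hu, hv]
  rw [h3, ← h2, ← h1]
  ring

/-- The `L¹` form of expansion. -/
theorem Expands.mul_sum_le {G : WGraph V} {φ : ℝ} (hG : G.Expands φ) (g : V → ℝ)
    (hg : ∀ u, 0 ≤ g u) (hs : 2 * (univ.filter fun u => g u ≠ 0).card ≤ Fintype.card V) :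
    φ * ∑ u, g u ≤ (∑ u, ∑ v, G.w u v * |g u - g v|) / 2 := by
  -- Layer-cake decomposition by induction on the size of the support: peel off the least positive
  -- value of `g` on the whole support and apply expansion to that set.
  induction hn : (univ.filter fun u => g u ≠ 0).card using Nat.strong_induction_on
    generalizing g with
  | _ N ih =>
  set S := univ.filter fun u => g u ≠ 0 with hS
  rcases S.eq_empty_or_nonempty with h0 | h0
  · have : g = 0 := by
      ext u
      by_contra h
      have : u ∈ S := by simpa [hS] using h
      simp [h0] at this
    simp [this]
  · obtain ⟨a, haS, ha⟩ := exists_min_image S g h0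
    have hmem : ∀ u, u ∈ S ↔ g u ≠ 0 := by simp [hS]
    have ha0 : 0 < g a := lt_of_le_of_ne (hg a) (Ne.symm ((hmem a).1 haS))
    set g' : V → ℝ := fun u => g u - g a * (if u ∈ S then 1 else 0) with hg'
    have hg'0 : ∀ u, 0 ≤ g' u := by
      intro u
      by_cases hu : u ∈ S
      · simpa [hg', hu] using ha u hu
      · simpa [hg', hu] using hg u
    have hlt : (univ.filter fun u => g' u ≠ 0).card < N := by
      rw [← hn]
      refine card_lt_card ⟨fun u hu => ?_, fun h => ?_⟩
      · rw [hmem]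
        intro h
        have huS : u ∉ S := by simp [hmem, h]
        simp [hg', h, huS] at hu
      · have := h haS
        simp [hg', haS] at this
    have hrec := ih _ hlt g' hg'0 (by omega) rfl
    have hcut := hG S h0.card_pos (by rw [hn]; omega)
    rw [cut_eq_sum_abs] at hcut
    have e1 : ∑ u, g u = ∑ u, g' u + g a * S.card := by
      simp only [hg', sum_sub_distrib, ← mul_sum]
      simp
    have e2 : ∑ u, ∑ v, G.w u v * |g u - g v| = ∑ u, ∑ v, G.w u v * |g' u - g' v| +
        g a * ∑ u, ∑ v, G.w u v *
          |(if u ∈ S then (1 : ℝ) else 0) - (if v ∈ S then 1 else 0)| := by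
      simp only [mul_sum, ← sum_add_distrib]
      refine sum_congr rfl fun u _ => sum_congr rfl fun v _ => ?_
      rw [mul_left_comm, ← mul_add]
      congr 1
      by_cases hu : u ∈ S <;> by_cases hv : v ∈ S
      · simp [hg', hu, hv]
      · have hv0 : g v = 0 := by simpa [hmem] using hv
        have := ha u hu
        simp only [hg', hu, hv, hv0, if_true, if_false, mul_one, mul_zero, sub_zero, abs_one]
        rw [abs_of_nonneg (hg u), abs_of_nonneg (by linarith)]; ring
      · have hu0 : g u = 0 := by simpa [hmem] using hu
        have := ha v hv
        simp only [hg', hu, hv, hu0, if_true, if_false, mul_one, mul_zero, zero_sub, abs_neg,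
          abs_one, sub_zero]
        rw [abs_of_nonneg (hg v), abs_of_nonneg (by linarith)]; ring
      · simp [hg', hu, hv]
    rw [e1, e2]
    have := mul_le_mul_of_nonneg_left hcut ha0.le
    linarith

/-- The `L¹` form applied to `g²`, with `|g u² - g v²| = |g u - g v| (g u + g v)` split by a
weighted AM–GM inequality into energy and degree terms. -/
theorem Expands.mul_sum_sq_le {G : WGraph V} {φ Δ : ℝ} (hφ : 0 < φ) (hG : G.Expands φ)
    (hd : ∀ u, G.wdeg u ≤ Δ) (hΔ : 0 < Δ) (g : V → ℝ)
    (hg : ∀ u, 0 ≤ g u) (hs : 2 * (univ.filter fun u => g u ≠ 0).card ≤ Fintype.card V) :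
    φ ^ 2 / (2 * Δ) * ∑ u, g u ^ 2 ≤ G.energy g := by
  have h1 := hG.mul_sum_le (fun u => g u ^ 2) (fun u => sq_nonneg _) (by simpa using hs)
  -- The AM–GM weight: with this value the degree term equals half of the left-hand side and is
  -- absorbed.
  set t : ℝ := 2 * Δ / φ with ht
  have ht0 : 0 < t := by positivity
  have h2 : ∑ u, ∑ v, G.w u v * |g u ^ 2 - g v ^ 2| ≤
      ∑ u, ∑ v, (t / 2 * (G.w u v * (g u - g v) ^ 2) +
        1 / t * (G.w u v * (g u ^ 2) + G.w u v * (g v ^ 2))) := by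
    refine sum_le_sum fun u _ => sum_le_sum fun v _ => ?_
    have hw := G.nonneg u v
    have : |g u ^ 2 - g v ^ 2| ≤ t / 2 * (g u - g v) ^ 2 + 1 / t * (g u ^ 2 + g v ^ 2) := by
      have hA : |g u ^ 2 - g v ^ 2| = |g u - g v| * (g u + g v) := by
        rw [show g u ^ 2 - g v ^ 2 = (g u - g v) * (g u + g v) by ring, abs_mul,
          abs_of_nonneg (add_nonneg (hg u) (hg v))]
      have hB : 0 ≤ 1 / (2 * t) * (t * |g u - g v| - (g u + g v)) ^ 2 := by positivity
      have hC : 1 / (2 * t) * (t * |g u - g v| - (g u + g v)) ^ 2 =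
          t / 2 * |g u - g v| ^ 2 - |g u - g v| * (g u + g v) +
            1 / (2 * t) * (g u + g v) ^ 2 := by
        field_simp; ring
      have hD : 1 / (2 * t) * (g u + g v) ^ 2 ≤ 1 / t * (g u ^ 2 + g v ^ 2) := by
        rw [show 1 / t * (g u ^ 2 + g v ^ 2) = 1 / (2 * t) * (2 * (g u ^ 2 + g v ^ 2)) by
          field_simp]
        refine mul_le_mul_of_nonneg_left ?_ (by positivity)
        nlinarith [sq_nonneg (g u - g v)]
      rw [hA]
      rw [sq_abs] at hC
      linarith
    calc G.w u v * |g u ^ 2 - g v ^ 2|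
        ≤ G.w u v * (t / 2 * (g u - g v) ^ 2 + 1 / t * (g u ^ 2 + g v ^ 2)) :=
          mul_le_mul_of_nonneg_left this hw
      _ = _ := by ring
  have hsw := G.sum_sum_w_mul_comm fun u _ => g u ^ 2
  simp only [sum_add_distrib, ← mul_sum] at h2
  simp only [mul_sum] at h2
  simp only [← mul_sum] at h2
  set E2 := ∑ u, ∑ v, G.w u v * (g u - g v) ^ 2 with hE2
  have hE : G.energy g = E2 / 2 := rfl
  have hswap : ∑ u, ∑ v, G.w u v * g v ^ 2 = ∑ u, ∑ v, G.w u v * g u ^ 2 := hsw.symm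
  have h2' : ∑ u, ∑ v, G.w u v * |g u ^ 2 - g v ^ 2| ≤
      t / 2 * E2 + 1 / t * (2 * (Δ * ∑ u, g u ^ 2)) := by
    refine h2.trans ?_
    refine add_le_add le_rfl (mul_le_mul_of_nonneg_left ?_ (by positivity))
    have h4 : ∑ u, G.wdeg u * g u ^ 2 ≤ Δ * ∑ u, g u ^ 2 := by
      rw [mul_sum]
      exact sum_le_sum fun u _ => mul_le_mul_of_nonneg_right (hd u) (sq_nonneg _)
    simp only [← sum_mul] at hswap ⊢
    rw [hswap]
    change ∑ u, G.wdeg u * g u ^ 2 + ∑ u, G.wdeg u * g u ^ 2 ≤ _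
    linarith
  have hQ : φ * ∑ u, g u ^ 2 ≤ (t / 2 * E2 + 1 / t * (2 * (Δ * ∑ u, g u ^ 2))) / 2 := by linarith
  have e3 : 1 / t * (2 * (Δ * ∑ u, g u ^ 2)) = φ * ∑ u, g u ^ 2 := by
    rw [ht]; field_simp
  have e4 : t / 2 * E2 = 2 * Δ / φ * G.energy g := by rw [hE, ht]; ring
  rw [e3, e4] at hQ
  have h7 : φ * ∑ u, g u ^ 2 ≤ 2 * Δ / φ * G.energy g := by linarith
  calc φ ^ 2 / (2 * Δ) * ∑ u, g u ^ 2 = φ / (2 * Δ) * (φ * ∑ u, g u ^ 2) := by ring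
    _ ≤ φ / (2 * Δ) * (2 * Δ / φ * G.energy g) := mul_le_mul_of_nonneg_left h7 (by positivity)
    _ = G.energy g := by field_simp

/-- Take `c` to be the least value of `f` that is exceeded on at most half of the vertices. The next
smaller value is exceeded on more than half, so fewer than half of the vertices lie below `c`. -/
theorem exists_median [Nonempty V] (f : V → ℝ) :
    ∃ c : ℝ, 2 * (univ.filter fun u => c < f u).card ≤ Fintype.card V ∧
      2 * (univ.filter fun u => f u < c).card ≤ Fintype.card V := by
  set T := univ.filter fun u => 2 * (univ.filter fun v => f u < f v).card ≤ Fintype.card V with hT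
  obtain ⟨a, -, ha⟩ := exists_max_image univ f univ_nonempty
  have hTn : T.Nonempty := by
    refine ⟨a, ?_⟩
    simp only [hT, mem_filter, mem_univ, true_and]
    rw [filter_false_of_mem fun v hv => not_lt.2 (ha v hv)]
    simp
  obtain ⟨b, hbT, hb⟩ := exists_min_image T f hTn
  refine ⟨f b, by simpa [hT] using hbT, ?_⟩
  rcases (univ.filter fun u => f u < f b).eq_empty_or_nonempty with h0 | h0
  · simp [h0]
  · obtain ⟨e, heS, he⟩ := exists_max_image _ f h0
    simp only [mem_filter, mem_univ, true_and] at heS he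
    have heT : e ∉ T := fun h => absurd (hb e h) (not_le.2 heS)
    simp only [hT, mem_filter, mem_univ, true_and, not_le] at heT
    have hle : (univ.filter fun v => f e < f v).card + (univ.filter fun u => f u < f b).card ≤
        Fintype.card V := by
      rw [← card_union_of_disjoint]
      · exact card_le_univ _
      · rw [disjoint_left]
        intro x hx hx'
        simp only [mem_filter, mem_univ, true_and] at hx hx'
        exact absurd (he x hx') (not_le.2 hx)
    omega

/-- The hard direction of Cheeger's inequality. -/
theorem Expands.hasGap {G : WGraph V} {φ Δ : ℝ} (hφ : 0 < φ) (hG : G.Expands φ)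
    (hd : ∀ u, G.wdeg u ≤ Δ) (hΔ : 0 < Δ) : G.HasGap (φ ^ 2 / (2 * Δ)) := by
  intro f hf
  rcases isEmpty_or_nonempty V with hV | hV
  · simp [energy]
  -- Cutting at a median makes the supports of the positive and negative parts of `f - c` small
  -- enough for the one-sided bound.
  obtain ⟨c, hc1, hc2⟩ := exists_median f
  have h1 := hG.mul_sum_sq_le hφ hd hΔ (fun u => max (f u - c) 0) (fun u => le_max_right _ _) (by
    refine le_trans (Nat.mul_le_mul_left 2 (card_le_card fun u hu => ?_)) hc1
    simp only [mem_filter, mem_univ, true_and, ne_eq, max_eq_right_iff, not_le] at hu ⊢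
    linarith)
  have h2 := hG.mul_sum_sq_le hφ hd hΔ (fun u => max (c - f u) 0) (fun u => le_max_right _ _) (by
    refine le_trans (Nat.mul_le_mul_left 2 (card_le_card fun u hu => ?_)) hc2
    simp only [mem_filter, mem_univ, true_and, ne_eq, max_eq_right_iff, not_le] at hu ⊢
    linarith)
  have h3 : G.energy (fun u => max (f u - c) 0) + G.energy (fun u => max (c - f u) 0) ≤
      G.energy f := by
    unfold energy
    rw [← add_div, ← sum_add_distrib]
    refine div_le_div_of_nonneg_right (sum_le_sum fun u _ => ?_) (by norm_num)
    rw [← sum_add_distrib]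
    refine sum_le_sum fun v _ => ?_
    rw [← mul_add]
    refine mul_le_mul_of_nonneg_left ?_ (G.nonneg u v)
    dsimp only
    rcases le_total (f u) c with hu | hu <;> rcases le_total (f v) c with hv | hv
    · rw [max_eq_right (by linarith), max_eq_right (by linarith), max_eq_left (by linarith),
        max_eq_left (by linarith)]
      nlinarith
    · rw [max_eq_right (by linarith), max_eq_left (by linarith), max_eq_left (by linarith),
        max_eq_right (by linarith)]
      nlinarith [mul_nonneg (sub_nonneg.2 hu) (sub_nonneg.2 hv)]
    · rw [max_eq_left (by linarith), max_eq_right (by linarith), max_eq_right (by linarith),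
        max_eq_left (by linarith)]
      nlinarith [mul_nonneg (sub_nonneg.2 hu) (sub_nonneg.2 hv)]
    · rw [max_eq_left (by linarith), max_eq_left (by linarith), max_eq_right (by linarith),
        max_eq_right (by linarith)]
      nlinarith
  -- The mean-zero hypothesis removes the linear term of `∑ (f - c)²`, so shifting by `c` can only
  -- increase the norm.
  have h4 : ∑ u, f u ^ 2 ≤ ∑ u, max (f u - c) 0 ^ 2 + ∑ u, max (c - f u) 0 ^ 2 := by
    have e : ∑ u, max (f u - c) 0 ^ 2 + ∑ u, max (c - f u) 0 ^ 2 =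
        ∑ u, (f u ^ 2 - 2 * c * f u + c ^ 2) := by
      rw [← sum_add_distrib]
      refine sum_congr rfl fun u _ => ?_
      rcases le_total (f u) c with h | h
      · rw [max_eq_right (by linarith), max_eq_left (by linarith)]; ring
      · rw [max_eq_left (by linarith), max_eq_right (by linarith)]; ring
    rw [e, sum_add_distrib, sum_sub_distrib, ← mul_sum, hf]
    have : 0 ≤ ∑ _u : V, c ^ 2 := sum_nonneg fun _ _ => sq_nonneg _
    linarith
  have h5 := mul_le_mul_of_nonneg_left h4 (show 0 ≤ φ ^ 2 / (2 * Δ) by positivity)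
  linarith

/-- In an almost regular weighted graph with a spectral gap all resistances are close to
`2 / D`. -/
theorem abs_resistance_sub_le (G : WGraph V) {l D W η : ℝ} (hl : 0 < l) (hG : G.HasGap l)
    (hD : 0 < D) (hη : η ≤ 1 / 2) (hdeg : ∀ u, |G.wdeg u - D| ≤ η * D)
    (hW : ∀ u v, G.w u v ≤ W) {u v : V} (huv : u ≠ v) :
    |G.resistance u v - 2 / D| ≤ 2 / D * (2 * η + 4 * W / D + 4 * W / l) := by
  have hlow : ∀ u, D / 2 ≤ G.wdeg u := by
    intro u
    have := (abs_le.1 (hdeg u)).1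
    nlinarith
  have hpos : ∀ u, 0 < G.wdeg u := fun u => lt_of_lt_of_le (by positivity) (hlow u)
  have hW0 : 0 ≤ W := (G.nonneg u v).trans (hW u v)
  obtain ⟨e, he0, he, hR⟩ := G.exists_resistance_eq hl hG huv (hpos u) (hpos v)
  have he' : e ≤ 8 * W / (l * D) := by
    rw [le_div_iff₀ (by positivity)]
    have := he.trans (G.sum_sq_div_sub_div_le hD hlow hW u v)
    rw [le_div_iff₀ hD] at this
    linarith
  have hinv : ∀ u, |1 / G.wdeg u - 1 / D| ≤ 2 * η / D := by
    intro u
    have h0 := hpos u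
    rw [div_sub_div _ _ h0.ne' hD.ne', abs_div, abs_of_pos (mul_pos h0 hD), one_mul, mul_one,
      abs_sub_comm, div_le_div_iff₀ (by positivity) hD]
    have h1 := hdeg u
    have h2 := hlow u
    have hη0 : 0 ≤ η := by
      have := (abs_nonneg _).trans h1
      exact nonneg_of_mul_nonneg_left this hD
    calc |G.wdeg u - D| * D ≤ η * D * D := mul_le_mul_of_nonneg_right h1 hD.le
      _ = 2 * η * (D / 2 * D) := by ring
      _ ≤ 2 * η * (G.wdeg u * D) := by gcongr
  have hw : 2 * G.w u v / (G.wdeg u * G.wdeg v) ≤ 8 * W / D ^ 2 := by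
    rw [div_le_div_iff₀ (mul_pos (hpos u) (hpos v)) (by positivity)]
    have h1 : D ^ 2 ≤ 4 * (G.wdeg u * G.wdeg v) := by
      have := mul_le_mul (hlow u) (hlow v) (by positivity) (hpos u).le
      nlinarith
    calc 2 * G.w u v * D ^ 2 ≤ 2 * W * (4 * (G.wdeg u * G.wdeg v)) := by
          gcongr
          exact hW u v
      _ = _ := by ring
  have hw0 : 0 ≤ 2 * G.w u v / (G.wdeg u * G.wdeg v) :=
    div_nonneg (mul_nonneg (by norm_num) (G.nonneg u v)) (mul_pos (hpos u) (hpos v)).le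
  have hu := abs_le.1 (hinv u)
  have hv := abs_le.1 (hinv v)
  have e1 : 2 / D * (2 * η + 4 * W / D + 4 * W / l) =
      2 * η / D + 2 * η / D + 8 * W / D ^ 2 + 8 * W / (l * D) := by
    field_simp
    ring
  have e2 : 2 / D = 1 / D + 1 / D := by ring
  have h3 : 0 ≤ 8 * W / D ^ 2 := by positivity
  have h4 : 0 ≤ 8 * W / (l * D) := by positivity
  rw [e1, hR, e2, abs_le]
  constructor <;> linarith [hu.1, hu.2, hv.1, hv.2]

end WGraph

end ResSparse

namespace ResSparse

open Finset

/-! ### Counting on finite product spaces -/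

open Classical in
/-- The number of points with a given property. -/
noncomputable def count {Ω : Type*} [Fintype Ω] (Q : Ω → Prop) : ℝ :=
  ((univ.filter Q).card : ℝ)

section Count

variable {Ω : Type*} [Fintype Ω]

theorem count_mono {Q R : Ω → Prop} (h : ∀ c, Q c → R c) : count Q ≤ count R := by
  classical
  exact Nat.cast_le.2 (card_le_card fun c hc => by simp at hc ⊢; exact h c hc)

open Classical in
theorem count_eq_sum (Q : Ω → Prop) : count Q = ∑ c, if Q c then (1 : ℝ) else 0 := by
  simp [count]

theorem count_or_le (Q R : Ω → Prop) : count (fun c => Q c ∨ R c) ≤ count Q + count R := by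
  classical
  simp only [count_eq_sum, ← sum_add_distrib]
  refine sum_le_sum fun c _ => ?_
  by_cases hQ : Q c <;> by_cases hR : R c <;> simp [hQ, hR]

theorem count_exists_le {κ : Type*} [Fintype κ] (Q : κ → Ω → Prop) :
    count (fun c => ∃ i, Q i c) ≤ ∑ i, count (Q i) := by
  classical
  simp only [count_eq_sum]
  rw [sum_comm]
  refine sum_le_sum fun c _ => ?_
  have h0 : ∀ i ∈ (univ : Finset κ), (0 : ℝ) ≤ if Q i c then 1 else 0 := by
    intro i _; split_ifs <;> norm_num
  split_ifs with h
  · obtain ⟨i, hi⟩ := h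
    calc (1 : ℝ) = if Q i c then 1 else 0 := by simp [hi]
      _ ≤ _ := single_le_sum h0 (mem_univ i)
  · exact sum_nonneg h0

theorem count_not (Q : Ω → Prop) : count (fun c => ¬ Q c) = Fintype.card Ω - count Q := by
  classical
  rw [count_eq_sum, count_eq_sum, eq_sub_iff_add_eq, ← sum_add_distrib,
    sum_congr rfl (g := fun _ => (1 : ℝ)) fun c _ => by by_cases hQ : Q c <;> simp [hQ]]
  simp

/-- Conditioning on the coordinates in `S`: if `Φ y x` depends on `y` only through `S` and on `x`
only through the complement of `S`, the two arguments can be drawn independently. -/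
theorem card_mul_count_diag {ι α : Type*} [Fintype ι] [Fintype α] [DecidableEq ι]
    (S : ι → Prop) [DecidablePred S] (Φ : (ι → α) → (ι → α) → Prop)
    (h₁ : ∀ y y' x, (∀ i, S i → y i = y' i) → Φ y x → Φ y' x)
    (h₂ : ∀ y x x', (∀ i, ¬ S i → x i = x' i) → Φ y x → Φ y x') :
    Fintype.card (ι → α) * count (fun c => Φ c c) = ∑ y, count (Φ y) := by
  classical
  have e1 : (Fintype.card (ι → α) : ℝ) * count (fun c => Φ c c) =
      ∑ z : (ι → α) × (ι → α), if Φ z.1 z.1 then (1 : ℝ) else 0 := by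
    rw [Fintype.sum_prod_type_right, count_eq_sum]
    simp
  have e2 : ∑ y, count (Φ y) = ∑ z : (ι → α) × (ι → α), if Φ z.1 z.2 then (1 : ℝ) else 0 := by
    rw [Fintype.sum_prod_type]
    exact sum_congr rfl fun y _ => count_eq_sum _
  -- Exchanging the two samples outside `S` is a bijection of the product space, and it turns a
  -- diagonal value of `Φ` into one with independent arguments.
  let σ : (ι → α) × (ι → α) → (ι → α) × (ι → α) := fun z =>
    (fun i => if S i then z.1 i else z.2 i, fun i => if S i then z.2 i else z.1 i)
  have hσ : Function.Involutive σ := by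
    intro z
    ext i <;> by_cases hi : S i <;> simp [σ, hi]
  rw [e1, e2, ← (Equiv.sum_comp hσ.toPerm fun z => if Φ z.1 z.1 then (1 : ℝ) else 0)]
  refine sum_congr rfl fun z _ => ?_
  have : Φ (σ z).1 (σ z).1 ↔ Φ z.1 z.2 := by
    constructor
    · intro h
      exact h₂ _ _ _ (fun i hi => by simp [σ, hi]) (h₁ _ z.1 _ (fun i hi => by simp [σ, hi]) h)
    · intro h
      exact h₂ _ _ _ (fun i hi => by simp [σ, hi]) (h₁ _ (σ z).1 _ (fun i hi => by simp [σ, hi]) h)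
  simp only [Function.Involutive.coe_toPerm, this]

/-- A restriction of uniformly random coins to some of them is uniformly random. -/
theorem count_comp_injective {κ τ : Type*} [Fintype κ] [Fintype τ] [DecidableEq τ]
    [DecidableEq κ] (e : κ → τ) (he : Function.Injective e) (Q : (κ → Bool) → Prop) :
    count (fun r : τ → Bool => Q fun i => r (e i)) * 2 ^ Fintype.card κ =
      count Q * 2 ^ Fintype.card τ := by
  classical
  have e1 : count (fun r : τ → Bool => Q fun i => r (e i)) * 2 ^ Fintype.card κ =
      ∑ z : (τ → Bool) × (κ → Bool), if Q fun i => z.1 (e i) then (1 : ℝ) else 0 := by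
    rw [Fintype.sum_prod_type_right, count_eq_sum]
    simp [mul_comm]
  have e2 : count Q * 2 ^ Fintype.card τ =
      ∑ z : (τ → Bool) × (κ → Bool), if Q z.2 then (1 : ℝ) else 0 := by
    rw [Fintype.sum_prod_type, count_eq_sum]
    simp [mul_comm]
  -- Exchanges `c` with the coins of `r` at the positions `e i`.
  let σ : (τ → Bool) × (κ → Bool) → (τ → Bool) × (κ → Bool) := fun z =>
    (Function.extend e z.2 z.1, fun i => z.1 (e i))
  have hσ : Function.Involutive σ := by
    rintro ⟨r, c⟩
    refine Prod.ext ?_ ?_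
    · funext j
      by_cases hj : ∃ i, e i = j
      · obtain ⟨i, rfl⟩ := hj
        simp [σ, he.extend_apply]
      · simp [σ, Function.extend_apply' _ _ _ hj]
    · funext i
      simp [σ, he.extend_apply]
  rw [e1, e2, ← (Equiv.sum_comp hσ.toPerm fun z => if Q z.2 then (1 : ℝ) else 0)]
  rfl

end Count

/-! ### A Chernoff bound -/

section Chernoff

variable {ι α : Type*} [Fintype ι] [DecidableEq ι] [Fintype α] [DecidableEq α]

/-- Divided by `Fintype.card α`, this is the moment generating function of a Bernoulli variable of
mean `1 / Fintype.card α`. It follows from `exp x ≤ 1 + x + x²` for `|x| ≤ 1` and `1 + y ≤ exp y`.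
-/
theorem sum_exp_le (a₀ : α) {x : ℝ} (hx : |x| ≤ 1) :
    ∑ a : α, Real.exp (x * (if a = a₀ then 1 else 0)) ≤
      Fintype.card α * Real.exp ((x + x ^ 2) / Fintype.card α) := by
  have hK : (0 : ℝ) < Fintype.card α := by
    have : 0 < Fintype.card α := Fintype.card_pos_iff.2 ⟨a₀⟩
    exact_mod_cast this
  have h1 : ∀ a : α, Real.exp (x * (if a = a₀ then 1 else 0)) =
      1 + (if a = a₀ then Real.exp x - 1 else 0) := by
    intro a; split_ifs <;> simp
  simp only [h1, sum_add_distrib, sum_ite_eq', mem_univ, if_true, sum_const, card_univ,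
    nsmul_eq_mul, mul_one]
  have h2 := (abs_le.1 (Real.abs_exp_sub_one_sub_id_le hx)).2
  have h3 := Real.add_one_le_exp ((x + x ^ 2) / Fintype.card α)
  calc (Fintype.card α : ℝ) + (Real.exp x - 1)
      ≤ Fintype.card α + (x + x ^ 2) := by linarith
    _ = Fintype.card α * ((x + x ^ 2) / Fintype.card α + 1) := by field_simp; ring
    _ ≤ _ := mul_le_mul_of_nonneg_left h3 hK.le

/-- Exponential Markov inequality plus independence of the coordinates. The sign of `θ` is free, so
both tails are covered. -/
theorem count_le_exp (a₀ : α) (a : ι → ℝ) (θ t : ℝ) (h : ∀ e, |θ * a e| ≤ 1) :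
    count (fun c : ι → α => t ≤ θ * (∑ e, a e * (if c e = a₀ then 1 else 0) -
        (∑ e, a e) / Fintype.card α)) ≤
      Fintype.card (ι → α) * Real.exp (-t + θ ^ 2 * (∑ e, a e ^ 2) / Fintype.card α) := by
  classical
  set K : ℝ := (Fintype.card α : ℝ)
  set F : (ι → α) → ℝ := fun c => ∑ e, a e * (if c e = a₀ then 1 else 0)
  have h1 : count (fun c : ι → α => t ≤ θ * (F c - (∑ e, a e) / K)) ≤
      ∑ c : ι → α, Real.exp (θ * (F c - (∑ e, a e) / K) - t) := by
    rw [count_eq_sum]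
    refine sum_le_sum fun c _ => ?_
    split_ifs with hc
    · exact Real.one_le_exp (by linarith)
    · exact (Real.exp_pos _).le
  have h2 : ∑ c : ι → α, Real.exp (θ * (F c - (∑ e, a e) / K) - t) =
      Real.exp (-t - θ * (∑ e, a e) / K) *
        ∏ e, ∑ x : α, Real.exp (θ * a e * (if x = a₀ then 1 else 0)) := by
    rw [prod_univ_sum, Fintype.piFinset_univ, mul_sum]
    refine sum_congr rfl fun c _ => ?_
    rw [← Real.exp_sum, ← Real.exp_add]
    congr 1
    simp only [F, mul_assoc, ← mul_sum]
    ring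
  have h3 : ∏ e, ∑ x : α, Real.exp (θ * a e * (if x = a₀ then 1 else 0)) ≤
      ∏ e : ι, (K * Real.exp ((θ * a e + (θ * a e) ^ 2) / K)) :=
    prod_le_prod (fun e _ => sum_nonneg fun x _ => (Real.exp_pos _).le)
      fun e _ => sum_exp_le a₀ (h e)
  have h4 : ∏ e : ι, (K * Real.exp ((θ * a e + (θ * a e) ^ 2) / K)) =
      Fintype.card (ι → α) * Real.exp (θ * (∑ e, a e) / K + θ ^ 2 * (∑ e, a e ^ 2) / K) := by
    rw [prod_mul_distrib, prod_const, card_univ, ← Real.exp_sum, Fintype.card_fun]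
    push_cast
    congr 2
    rw [← sum_div, sum_add_distrib, add_div, ← mul_sum]
    simp only [mul_pow, ← mul_sum]
  refine h1.trans ?_
  rw [h2]
  refine (mul_le_mul_of_nonneg_left h3 (Real.exp_pos _).le).trans (le_of_eq ?_)
  rw [h4, mul_left_comm, ← Real.exp_add]
  congr 2
  ring

end Chernoff

end ResSparse

namespace ResSparse

open Finset

/-! ### Random subgraphs -/

section Sample

variable {n : ℕ} (G : SimpleGraph (Fin n)) [DecidableRel G.Adj]
  {α : Type*} [DecidableEq α] (a₀ : α)

/-- The outcome for the pair `j < i`: it is kept if it is an edge and its random value is `a₀`. -/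
def half (c : Fin n × Fin n → α) (i j : Fin n) : ℕ :=
  if j < i ∧ G.Adj i j ∧ c (i, j) = a₀ then 1 else 0

/-- The adjacency matrix of the random subgraph. -/
def sample (c : Fin n × Fin n → α) (i j : Fin n) : ℕ := half G a₀ c i j + half G a₀ c j i

/-- The degrees of the random subgraph. -/
def sampleDeg (c : Fin n × Fin n → α) (i : Fin n) : ℕ := ∑ j, sample G a₀ c i j

theorem sample_comm (c : Fin n × Fin n → α) (i j : Fin n) :
    sample G a₀ c i j = sample G a₀ c j i := add_comm _ _

theorem sample_le_one (c : Fin n × Fin n → α) (i j : Fin n) : sample G a₀ c i j ≤ 1 := by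
  unfold sample half
  rcases lt_or_ge i j with h | h
  · rw [if_neg (fun h' => absurd h'.1 (not_lt.2 h.le))]
    split_ifs <;> simp
  · rw [if_neg (c := i < j ∧ _) (fun h' => absurd h'.1 (not_lt.2 h))]
    split_ifs <;> simp

theorem sample_eq_zero_of_not_adj (c : Fin n × Fin n → α) {i j : Fin n} (h : ¬ G.Adj i j) :
    sample G a₀ c i j = 0 := by
  unfold sample half
  rw [if_neg (fun h' => h h'.2.1), if_neg (fun h' => h h'.2.1.symm)]

theorem sample_congr {c c' : Fin n × Fin n → α} {i j : Fin n} (h : c (i, j) = c' (i, j))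
    (h' : c (j, i) = c' (j, i)) : sample G a₀ c i j = sample G a₀ c' i j := by
  unfold sample half
  rw [h, h']

/-- The coefficients of a linear statistic of the subgraph in terms of the independent outcomes. -/
def coeff (g : Fin n → Fin n → ℝ) (e : Fin n × Fin n) : ℝ :=
  if e.2 < e.1 ∧ G.Adj e.1 e.2 then g e.1 e.2 + g e.2 e.1 else 0

/-- Both orientations of a pair are decided by the outcome at the index with the larger vertex
first; merging them gives a linear form in independent variables. -/
theorem sum_mul_sample (g : Fin n → Fin n → ℝ) (c : Fin n × Fin n → α) :
    ∑ i, ∑ j, g i j * (sample G a₀ c i j : ℝ) =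
      ∑ e, coeff G g e * (if c e = a₀ then 1 else 0) := by
  rw [Fintype.sum_prod_type]
  have h1 : ∑ i, ∑ j, g i j * (half G a₀ c j i : ℝ) =
      ∑ i, ∑ j, g j i * (half G a₀ c i j : ℝ) := sum_comm
  simp only [sample, Nat.cast_add, mul_add, sum_add_distrib, h1]
  simp only [← sum_add_distrib]
  refine sum_congr rfl fun i _ => sum_congr rfl fun j _ => ?_
  unfold coeff half
  by_cases h2 : j < i ∧ G.Adj i j <;> by_cases h3 : c (i, j) = a₀
  · simp [h2, h3]
  · simp [h3]
  · rw [if_neg (fun h => h2 ⟨h.1, h.2.1⟩)]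
    simp [h2]
  · simp [h3]

theorem sum_coeff (g : Fin n → Fin n → ℝ) :
    ∑ e, coeff G g e = ∑ i, ∑ j, g i j * (if G.Adj i j then 1 else 0) := by
  rw [Fintype.sum_prod_type]
  have h0 : ∀ i j, coeff G g (i, j) = (if j < i ∧ G.Adj i j then g i j else 0) +
      (if j < i ∧ G.Adj i j then g j i else 0) := by
    intro i j; unfold coeff; split_ifs <;> simp
  have h1 : ∑ i, ∑ j, (if j < i ∧ G.Adj i j then g j i else 0) =
      ∑ i, ∑ j, (if i < j ∧ G.Adj j i then g i j else 0) := sum_comm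
  simp only [h0, sum_add_distrib, h1]
  simp only [← sum_add_distrib]
  refine sum_congr rfl fun i _ => sum_congr rfl fun j _ => ?_
  by_cases h : G.Adj i j
  · rcases lt_trichotomy i j with h' | h' | h'
    · simp [h, h.symm, h', h'.le]
    · exact absurd h' h.ne
    · simp [h, h.symm, h', h'.le]
  · have h' : ¬ G.Adj j i := fun h' => h h'.symm
    simp [h, h']

variable [Fintype α]

/-- Concentration of linear statistics of the random subgraph. -/
theorem count_sample_le (g : Fin n → Fin n → ℝ) (hg0 : ∀ i j, 0 ≤ g i j)
    (hg1 : ∀ i j, g i j ≤ 1) {θ s M M' : ℝ} (hθ : 0 ≤ θ) (hθ' : θ ≤ 1 / 2)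
    (hM : (∑ i, ∑ j, g i j * (if G.Adj i j then 1 else 0)) / Fintype.card α = M)
    (hM' : M ≤ M') :
    count (fun c : Fin n × Fin n → α =>
        s ≤ |∑ i, ∑ j, g i j * (sample G a₀ c i j : ℝ) - M|) ≤
      Fintype.card (Fin n × Fin n → α) * (2 * Real.exp (-(θ * s) + 2 * θ ^ 2 * M')) := by
  have ha0 : ∀ e, 0 ≤ coeff G g e := by
    intro e
    unfold coeff
    split_ifs
    · exact add_nonneg (hg0 _ _) (hg0 _ _)
    · exact le_rfl
  have ha2 : ∀ e, coeff G g e ≤ 2 := by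
    intro e
    unfold coeff
    split_ifs
    · linarith [hg1 e.1 e.2, hg1 e.2 e.1]
    · norm_num
  -- The coefficients lie in `[0, 2]`, so each square is at most twice the coefficient and the mean
  -- controls the variance.
  have hsq : (∑ e, coeff G g e ^ 2) / Fintype.card α ≤ 2 * M' := by
    calc (∑ e, coeff G g e ^ 2) / Fintype.card α
        ≤ (∑ e, 2 * coeff G g e) / Fintype.card α := by
          refine div_le_div_of_nonneg_right (sum_le_sum fun e _ => ?_) (Nat.cast_nonneg _)
          nlinarith [ha0 e, ha2 e]
      _ = 2 * M := by rw [← mul_sum, sum_coeff, mul_div_assoc, hM]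
      _ ≤ 2 * M' := by linarith
  have hbound : ∀ τ : ℝ, |τ| = θ → count (fun c : Fin n × Fin n → α =>
      θ * s ≤ τ * (∑ i, ∑ j, g i j * (sample G a₀ c i j : ℝ) - M)) ≤
      Fintype.card (Fin n × Fin n → α) * Real.exp (-(θ * s) + 2 * θ ^ 2 * M') := by
    intro τ hτ
    have h := count_le_exp a₀ (coeff G g) τ (θ * s) (by
      intro e
      rw [abs_mul, hτ, abs_of_nonneg (ha0 e)]
      nlinarith [ha0 e, ha2 e])
    simp only [← sum_mul_sample, sum_coeff, hM] at h
    refine h.trans (mul_le_mul_of_nonneg_left (Real.exp_le_exp.2 ?_) (Nat.cast_nonneg _))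
    rw [mul_div_assoc, ← sq_abs τ, hτ]
    have := mul_le_mul_of_nonneg_left hsq (sq_nonneg θ)
    linarith
  have h1 := hbound θ (abs_of_nonneg hθ)
  have h2 := hbound (-θ) (by rw [abs_neg, abs_of_nonneg hθ])
  refine (count_mono (R := fun c => θ * s ≤ θ * (∑ i, ∑ j, g i j * (sample G a₀ c i j : ℝ) - M) ∨
      θ * s ≤ -θ * (∑ i, ∑ j, g i j * (sample G a₀ c i j : ℝ) - M)) fun c hc => ?_).trans
    ((count_or_le _ _).trans (by linarith))
  rcases le_abs.1 hc with h | h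
  · exact Or.inl (mul_le_mul_of_nonneg_left h hθ)
  · right
    have := mul_le_mul_of_nonneg_left h hθ
    linarith

/-- The properties of the random subgraph from which the sparsifier is built: `d` is the expected
degree. -/
structure IsGood (c : Fin n × Fin n → α) (d l γ : ℝ) : Prop where
  deg : ∀ v, (sampleDeg G a₀ c v - d) ^ 2 ≤ 32 * d * l
  -- This counts two-step walks from `v` that do not return. Given the edges at `v`, each sampled
  -- neighbour has `D - 1` further edges of `G`, whence the mean `d - 1 / Fintype.card α` per
  -- neighbour.
  nbr : ∀ v, |∑ u, (sample G a₀ c v u : ℝ) * ∑ w, (if w = v then 0 else (sample G a₀ c u w : ℝ)) -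
    sampleDeg G a₀ c v * (d - 1 / Fintype.card α)| ≤ 8 * d * l
  cut : ∀ S : Finset (Fin n), 0 < S.card → 2 * S.card ≤ n →
    γ * d * S.card / 2 ≤ ∑ u ∈ S, ∑ v ∈ Sᶜ, (sample G a₀ c u v : ℝ)

variable {D : ℕ} {d l γ : ℝ}

theorem sum_adj_of_regular (hG : G.IsRegularOfDegree D) (v : Fin n) :
    ∑ j, (if G.Adj v j then (1 : ℝ) else 0) = D := by
  have h := hG v
  rw [← h, ← G.card_neighborFinset_eq_degree, G.neighborFinset_eq_filter]
  simp

theorem count_deg_le (hG : G.IsRegularOfDegree D) (hd : (D : ℝ) / Fintype.card α = d)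
    (hl : 0 ≤ l) (hd0 : 0 < d) (hld : 8 * l ≤ d) (v : Fin n) :
    count (fun c : Fin n × Fin n → α => ¬ ((sampleDeg G a₀ c v - d) ^ 2 ≤ 32 * d * l)) ≤
      Fintype.card (Fin n × Fin n → α) * (2 * Real.exp (-(4 * l))) := by
  have hs : ∀ F : Fin n → Fin n → ℝ, ∑ i, ∑ j, (if i = v then (1 : ℝ) else 0) * F i j =
      ∑ j, F v j := by
    intro F
    simp only [ite_mul, one_mul, zero_mul]
    simp
  set s := Real.sqrt (32 * d * l) with hsdef
  have hs0 : 0 ≤ s := Real.sqrt_nonneg _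
  have hs2 : s ^ 2 = 32 * d * l := Real.sq_sqrt (by positivity)
  have hsd : s ≤ 2 * d := by
    rw [hsdef, Real.sqrt_le_left (by positivity)]
    nlinarith
  -- `θ = s / (4 * d)` minimizes the exponent, with value `-s² / (8 d) = -4 l`; `8 * l ≤ d` keeps `θ
  -- ≤ 1 / 2`.
  have h := count_sample_le G a₀ (fun i _ => if i = v then (1 : ℝ) else 0)
    (fun i _ => by split_ifs <;> norm_num) (fun i _ => by split_ifs <;> norm_num)
    (θ := s / (4 * d)) (s := s) (M := d) (M' := d) (by positivity)
    (by rw [div_le_div_iff₀ (by positivity) (by norm_num)]; linarith)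
    (by rw [hs, sum_adj_of_regular G hG, hd]) le_rfl
  refine (count_mono fun c hc => ?_).trans (h.trans (le_of_eq ?_))
  · rw [hs fun i j => (sample G a₀ c i j : ℝ)]
    have e : ∑ j, (sample G a₀ c v j : ℝ) = sampleDeg G a₀ c v := by
      rw [sampleDeg]; push_cast; rfl
    rw [e]
    refine abs_le_of_sq_le_sq' ?_ (abs_nonneg _) |>.2
    rw [sq_abs, hs2]
    exact (not_le.1 hc).le
  · congr 3
    have : -(s / (4 * d) * s) + 2 * (s / (4 * d)) ^ 2 * d = -(s ^ 2 / (8 * d)) := by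
      field_simp; ring
    rw [this, hs2]
    field_simp
    ring

/-- Condition on the edges at `v`: the sum is then linear in the remaining edges with coefficients
`0` and `1`. The degree bound belongs to the event because it bounds the conditional mean by `2 d²`;
then `θ = 1 / d` gives the exponent `-8 l + 4 ≤ -4 l`. -/
theorem count_nbr_le (hG : G.IsRegularOfDegree D) (hd : (D : ℝ) / Fintype.card α = d)
    (hl : 1 ≤ l) (hld : 8 * l ≤ d) (v : Fin n) :
    count (fun c : Fin n × Fin n → α => (sampleDeg G a₀ c v : ℝ) ≤ 2 * d ∧
      ¬ (|∑ u, (sample G a₀ c v u : ℝ) * ∑ w, (if w = v then 0 else (sample G a₀ c u w : ℝ)) -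
        sampleDeg G a₀ c v * (d - 1 / Fintype.card α)| ≤ 8 * d * l)) ≤
      Fintype.card (Fin n × Fin n → α) * (2 * Real.exp (-(4 * l))) := by
  have hd0 : 0 < d := by linarith
  rcases isEmpty_or_nonempty (Fin n × Fin n → α) with hE | hE
  · rw [count_eq_sum]; simp
  set Φ : (Fin n × Fin n → α) → (Fin n × Fin n → α) → Prop := fun y x =>
    (sampleDeg G a₀ y v : ℝ) ≤ 2 * d ∧
      ¬ (|∑ u, (sample G a₀ y v u : ℝ) * ∑ w, (if w = v then 0 else (sample G a₀ x u w : ℝ)) -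
        sampleDeg G a₀ y v * (d - 1 / Fintype.card α)| ≤ 8 * d * l) with hΦ
  have key := card_mul_count_diag (fun e : Fin n × Fin n => e.1 = v ∨ e.2 = v) Φ
    (by
      intro y y' x h hy
      have e : ∀ u, sample G a₀ y v u = sample G a₀ y' v u := fun u =>
        sample_congr G a₀ (h _ (Or.inl rfl)) (h _ (Or.inr rfl))
      simpa only [hΦ, sampleDeg, e] using hy)
    (by
      intro y x x' h hy
      have e : ∀ u w, (sample G a₀ y v u : ℝ) * (if w = v then 0 else (sample G a₀ x u w : ℝ)) =
          (sample G a₀ y v u : ℝ) * (if w = v then 0 else (sample G a₀ x' u w : ℝ)) := by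
        intro u w
        split_ifs with hw
        · rfl
        · by_cases hu : u = v
          · subst hu
            rw [sample_eq_zero_of_not_adj G a₀ y (G.irrefl)]
            simp
          · rw [sample_congr G a₀ (h _ (by simp [hu, hw])) (h _ (by simp [hu, hw]))]
      simpa only [hΦ, mul_sum, e] using hy)
  have hN : (0 : ℝ) < Fintype.card (Fin n × Fin n → α) := by exact_mod_cast Fintype.card_pos
  refine le_of_mul_le_mul_left ?_ hN
  refine key.le.trans ?_
  have hone : ∀ y, count (Φ y) ≤
      Fintype.card (Fin n × Fin n → α) * (2 * Real.exp (-(4 * l))) := by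
    intro y
    by_cases hy : (sampleDeg G a₀ y v : ℝ) ≤ 2 * d
    swap
    · have : count (Φ y) = 0 := by
        rw [count_eq_sum]
        exact sum_eq_zero fun c _ => if_neg fun h => hy h.1
      rw [this]; positivity
    have hX : ∀ u, (sample G a₀ y v u : ℝ) ≤ 1 := fun u => by
      exact_mod_cast sample_le_one G a₀ y v u
    have hmean : (∑ i, ∑ j, ((sample G a₀ y v i : ℝ) * (if j = v then 0 else 1)) *
        (if G.Adj i j then 1 else 0)) / Fintype.card α =
        sampleDeg G a₀ y v * (d - 1 / Fintype.card α) := by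
      have e : ∀ i, ∑ j, ((sample G a₀ y v i : ℝ) * (if j = v then 0 else 1)) *
          (if G.Adj i j then 1 else 0) = (sample G a₀ y v i : ℝ) * (D - 1) := by
        intro i
        by_cases hi : G.Adj v i
        · simp only [mul_assoc, ← mul_sum]
          congr 1
          rw [← sum_adj_of_regular G hG i, ← add_sum_erase univ _ (mem_univ v),
            ← add_sum_erase (a := v) univ (fun j => if G.Adj i j then (1 : ℝ) else 0) (mem_univ v)]
          simp only [if_true, zero_mul, zero_add, hi.symm, add_sub_cancel_left]
          refine sum_congr rfl fun j hj => ?_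
          rw [if_neg (ne_of_mem_erase hj), one_mul]
        · simp [sample_eq_zero_of_not_adj G a₀ y hi]
      rw [sum_congr rfl fun i _ => e i, ← sum_mul, sampleDeg, ← hd]
      push_cast
      ring
    have hp : 0 ≤ (1 : ℝ) / Fintype.card α := by positivity
    have h := count_sample_le G a₀ (fun i j => (sample G a₀ y v i : ℝ) * (if j = v then 0 else 1))
      (fun i j => by split_ifs <;> simp)
      (fun i j => by split_ifs <;> simp [sample_le_one])
      (θ := 1 / d) (s := 8 * d * l) (M' := 2 * d ^ 2) (by positivity)
      (by rw [div_le_div_iff₀ hd0 (by norm_num)]; linarith) hmean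
      (by
        have h1 : (0 : ℝ) ≤ sampleDeg G a₀ y v := Nat.cast_nonneg _
        have h2 : (sampleDeg G a₀ y v : ℝ) * (d - 1 / Fintype.card α) ≤
            sampleDeg G a₀ y v * d := mul_le_mul_of_nonneg_left (by linarith) h1
        nlinarith)
    refine (count_mono fun c hc => ?_).trans (h.trans ?_)
    · have e : ∑ i, ∑ j, ((sample G a₀ y v i : ℝ) * (if j = v then 0 else 1)) *
          (sample G a₀ c i j : ℝ) =
          ∑ u, (sample G a₀ y v u : ℝ) * ∑ w, (if w = v then 0 else (sample G a₀ c u w : ℝ)) := by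
        refine sum_congr rfl fun i _ => ?_
        rw [mul_sum]
        refine sum_congr rfl fun j _ => ?_
        split_ifs <;> ring
      rw [e]
      exact (not_le.1 hc.2).le
    · refine mul_le_mul_of_nonneg_left (mul_le_mul_of_nonneg_left (Real.exp_le_exp.2 ?_)
        (by norm_num)) hN.le
      have : -(1 / d * (8 * d * l)) + 2 * (1 / d) ^ 2 * (2 * d ^ 2) = -(8 * l) + 4 := by
        field_simp
        ring
      rw [this]
      linarith
  calc ∑ y, count (Φ y) ≤ ∑ _y : Fin n × Fin n → α,
        (Fintype.card (Fin n × Fin n → α) : ℝ) * (2 * Real.exp (-(4 * l))) :=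
        sum_le_sum fun y _ => hone y
    _ = _ := by rw [sum_const, nsmul_eq_mul, card_univ]

theorem sum_cut_eq (S : Finset (Fin n)) (F : Fin n → Fin n → ℝ) :
    ∑ i, ∑ j, (if i ∈ S ∧ j ∉ S then (1 : ℝ) else 0) * F i j = ∑ u ∈ S, ∑ v ∈ Sᶜ, F u v := by
  rw [← sum_subset (subset_univ S) fun i _ hi => sum_eq_zero fun j _ => by simp [hi]]
  refine sum_congr rfl fun i hi => ?_
  rw [← sum_subset (subset_univ Sᶜ) fun j _ hj => by simp at hj; simp [hj]]
  refine sum_congr rfl fun j hj => ?_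
  simp at hj
  simp [hi, hj]

/-- The sampled cut has mean `M ≥ γ d |S|`, and losing half of it has exponent `-M / 32 ≤ -4 l |S|`.
The factor `|S|` makes the union bound over all sets affordable. -/
theorem count_cut_le (hd : (D : ℝ) / Fintype.card α = d)
    (hld : 128 * l ≤ γ * d) (S : Finset (Fin n))
    (hS : γ * D * S.card ≤ (WGraph.ofGraph G).cut S) :
    count (fun c : Fin n × Fin n → α =>
      ¬ (γ * d * S.card / 2 ≤ ∑ u ∈ S, ∑ v ∈ Sᶜ, (sample G a₀ c u v : ℝ))) ≤
      Fintype.card (Fin n × Fin n → α) * (2 * Real.exp (-(4 * l)) ^ S.card) := by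
  set M : ℝ := (WGraph.ofGraph G).cut S / Fintype.card α with hM
  have hMd : γ * d * S.card ≤ M := by
    rw [hM, ← hd]
    calc γ * (D / Fintype.card α) * S.card = γ * D * S.card / Fintype.card α := by ring
      _ ≤ _ := div_le_div_of_nonneg_right hS (Nat.cast_nonneg _)
  have h := count_sample_le G a₀ (fun i j => if i ∈ S ∧ j ∉ S then (1 : ℝ) else 0)
    (fun i j => by split_ifs <;> norm_num) (fun i j => by split_ifs <;> norm_num)
    (θ := 1 / 8) (s := M / 2) (M := M) (M' := M) (by norm_num) (by norm_num)
    (by rw [sum_cut_eq]; rfl) le_rfl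
  refine (count_mono fun c hc => ?_).trans (h.trans ?_)
  · rw [sum_cut_eq S fun i j => (sample G a₀ c i j : ℝ), abs_sub_comm]
    have := not_le.1 hc
    exact le_trans (by linarith) (le_abs_self _)
  · refine mul_le_mul_of_nonneg_left (mul_le_mul_of_nonneg_left ?_ (by norm_num))
      (Nat.cast_nonneg _)
    rw [← Real.exp_nat_mul]
    refine Real.exp_le_exp.2 ?_
    have : 128 * l * S.card ≤ γ * d * S.card :=
      mul_le_mul_of_nonneg_right hld (Nat.cast_nonneg _)
    linarith

/-- The random subgraph is good with probability at least `2/3`. -/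
theorem le_count_isGood (hG : G.IsRegularOfDegree D) (hd : (D : ℝ) / Fintype.card α = d)
    (hexp : (WGraph.ofGraph G).Expands (γ * D)) (hl : 1 ≤ l) (hld : 512 * l ≤ d)
    (hld' : 128 * l ≤ γ * d) (hn : 24 * n * Real.exp (-(4 * l)) ≤ 1) :
    2 / 3 * (Fintype.card (Fin n × Fin n → α) : ℝ) ≤
      count (fun c : Fin n × Fin n → α => IsGood G a₀ c d l γ) := by
  have hd0 : 0 < d := by linarith
  set N : ℝ := (Fintype.card (Fin n × Fin n → α) : ℝ) with hN
  have hN0 : 0 ≤ N := Nat.cast_nonneg _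
  set x := Real.exp (-(4 * l)) with hx
  have hx0 : 0 < x := Real.exp_pos _
  set Q₁ : Fin n → (Fin n × Fin n → α) → Prop := fun v c =>
    ¬ ((sampleDeg G a₀ c v - d) ^ 2 ≤ 32 * d * l)
  set Q₂ : Fin n → (Fin n × Fin n → α) → Prop := fun v c =>
    (sampleDeg G a₀ c v : ℝ) ≤ 2 * d ∧
      ¬ (|∑ u, (sample G a₀ c v u : ℝ) * ∑ w, (if w = v then 0 else (sample G a₀ c u w : ℝ)) -
        sampleDeg G a₀ c v * (d - 1 / Fintype.card α)| ≤ 8 * d * l)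
  set Q₃ : Finset (Fin n) → (Fin n × Fin n → α) → Prop := fun S c =>
    (0 < S.card ∧ 2 * S.card ≤ n) ∧
      ¬ (γ * d * S.card / 2 ≤ ∑ u ∈ S, ∑ v ∈ Sᶜ, (sample G a₀ c u v : ℝ))
  have h1 : count (fun c => ∃ v, Q₁ v c) ≤ N * (2 * n * x) := by
    refine (count_exists_le Q₁).trans ((sum_le_sum fun v _ =>
      count_deg_le G a₀ hG hd (by linarith) hd0 (by linarith) v).trans (le_of_eq ?_))
    rw [sum_const, card_univ, Fintype.card_fin, nsmul_eq_mul]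
    ring
  have h2 : count (fun c => ∃ v, Q₂ v c) ≤ N * (2 * n * x) := by
    refine (count_exists_le Q₂).trans ((sum_le_sum fun v _ =>
      count_nbr_le G a₀ hG hd hl (by linarith) v).trans (le_of_eq ?_))
    rw [sum_const, card_univ, Fintype.card_fin, nsmul_eq_mul]
    ring
  have hpow : ∑ S : Finset (Fin n), x ^ S.card = (1 + x) ^ n := by
    have := Fintype.sum_pow_mul_eq_add_pow (Fin n) x 1
    simpa [add_comm] using this
  have h3 : count (fun c => ∃ S, Q₃ S c) ≤ N * (4 * n * x) := by
    -- Removing the term `1` of the empty set turns the sum into `(1 + x) ^ n - 1`, which is at most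
    -- `2 n x`.
    have hS : ∀ S, count (Q₃ S) ≤ N * (2 * (x ^ S.card - if S = ∅ then 1 else 0)) := by
      intro S
      by_cases hS : 0 < S.card ∧ 2 * S.card ≤ n
      · have hne : S ≠ ∅ := card_pos.1 hS.1 |>.ne_empty
        rw [if_neg hne, sub_zero]
        refine (count_mono fun c hc => hc.2).trans (count_cut_le G a₀ hd hld' S ?_)
        exact hexp S hS.1 (by simpa using hS.2)
      · have h0 : count (Q₃ S) = 0 := by
          rw [count_eq_sum]
          exact sum_eq_zero fun c _ => if_neg fun h => hS h.1
        rw [h0]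
        refine mul_nonneg hN0 (mul_nonneg (by norm_num) ?_)
        split_ifs with hE
        · simp [hE]
        · rw [sub_zero]; positivity
    refine (count_exists_le Q₃).trans ((sum_le_sum fun S _ => hS S).trans ?_)
    rw [← mul_sum, ← mul_sum, sum_sub_distrib, hpow, sum_ite_eq', if_pos (mem_univ _)]
    refine mul_le_mul_of_nonneg_left ?_ hN0
    have hnx : (n : ℝ) * x ≤ 1 := by
      have : 0 ≤ (n : ℝ) * x := by positivity
      linarith
    have e1 : (1 + x) ^ n ≤ Real.exp (n * x) := by
      rw [Real.exp_nat_mul]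
      exact pow_le_pow_left₀ (by positivity) (by linarith [Real.add_one_le_exp x]) n
    have e2 := Real.abs_exp_sub_one_le (x := n * x) (by
      rw [abs_of_nonneg (by positivity)]; exact hnx)
    rw [abs_of_nonneg (show 0 ≤ (n : ℝ) * x by positivity)] at e2
    have e3 := (abs_le.1 e2).2
    linarith
  -- The three kinds of failure cost `2 n x`, `2 n x` and `4 n x`, together `8 n x ≤ 1 / 3`.
  have hbad : count (fun c : Fin n × Fin n → α => ¬ IsGood G a₀ c d l γ) ≤ N / 3 := by
    refine (count_mono (R := fun c => (∃ v, Q₁ v c) ∨ (∃ v, Q₂ v c) ∨ ∃ S, Q₃ S c)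
      fun c hc => ?_).trans ((count_or_le _ _).trans ((add_le_add_right (count_or_le _ _) _).trans
        ?_))
    · by_contra hcon
      push Not at hcon
      obtain ⟨g1, g2, g3⟩ := hcon
      have g1' : ∀ v, (sampleDeg G a₀ c v - d) ^ 2 ≤ 32 * d * l := fun v => not_not.1 (g1 v)
      refine hc ⟨g1', fun v => ?_, fun S hS hS' => ?_⟩
      · by_contra h
        refine g2 v ⟨?_, h⟩
        have h' : (sampleDeg G a₀ c v - d) ^ 2 ≤ d ^ 2 := (g1' v).trans (by nlinarith)
        linarith [(abs_le_of_sq_le_sq' h' hd0.le).2]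
      · by_contra h
        exact g3 S ⟨⟨hS, hS'⟩, h⟩
    · have : N * (24 * n * x) ≤ N * 1 := mul_le_mul_of_nonneg_left hn hN0
      linarith
  have := count_not (fun c : Fin n × Fin n → α => IsGood G a₀ c d l γ)
  linarith

end Sample

end ResSparse

namespace ResSparse

open Finset

/-! ### The sparsifier -/

/-- Two quantities within relative error `ε / 8` of the same `r` have a ratio within `1 ± ε`; the
graphs need not be compared directly. -/
theorem isResistanceSparsifier_of_abs_le {V : Type*} [Fintype V] [DecidableEq V]
    {G H : WGraph V} {r ε : ℝ} (hr : 0 ≤ r) (hε : 0 ≤ ε) (hε1 : ε ≤ 1)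
    (hsupp : H.support ≤ G.support)
    (hG : ∀ u v, u ≠ v → |G.resistance u v - r| ≤ r * (ε / 8))
    (hH : ∀ u v, u ≠ v → |H.resistance u v - r| ≤ r * (ε / 8)) :
    G.IsResistanceSparsifier H ε := by
  refine ⟨hsupp, fun u v => ?_⟩
  by_cases huv : u = v
  · subst huv
    simp [WGraph.resistance_self]
  · have h1 := abs_le.1 (hG u v huv)
    have h2 := abs_le.1 (hH u v huv)
    have h3 : 0 ≤ r * ε := mul_nonneg hr hε
    have h4 : r * ε * ε ≤ r * ε := mul_le_of_le_one_right h3 hε1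
    have h5 : 0 ≤ r * ε * ε := mul_nonneg h3 hε
    constructor
    · have := mul_le_mul_of_nonneg_left h2.2 (sub_nonneg.2 hε1)
      nlinarith [h1.1]
    · have := mul_le_mul_of_nonneg_left h2.1 (show 0 ≤ 1 + ε by linarith)
      nlinarith [h1.2]

theorem WGraph.ofGraph_wdeg {n D : ℕ} (G : SimpleGraph (Fin n)) [DecidableRel G.Adj]
    (hG : G.IsRegularOfDegree D) (v : Fin n) : (WGraph.ofGraph G).wdeg v = D :=
  sum_adj_of_regular G hG v

section Sparsifier

variable {n : ℕ} (G : SimpleGraph (Fin n)) [DecidableRel G.Adj]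
  {α : Type*} [DecidableEq α] [Fintype α] (a₀ : α) (D : ℕ)

/-- The weights of the sparsifier times `D`: every kept edge is rescaled, with a first-order
correction of the fluctuations of the degrees. -/
def weightNum (c : Fin n × Fin n → α) (i j : Fin n) : ℕ :=
  sample G a₀ c i j * (Fintype.card α *
    (3 * D - Fintype.card α * (sampleDeg G a₀ c i + sampleDeg G a₀ c j)))

/-- The sparsifier built from the random subgraph. -/
noncomputable def sparsifier (c : Fin n × Fin n → α) : WGraph (Fin n) where
  w i j := (weightNum G a₀ D c i j : ℝ) / D
  symm i j := by
    rw [weightNum, weightNum, sample_comm, add_comm (sampleDeg G a₀ c i)]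
  loopless i := by
    simp [weightNum, sample_eq_zero_of_not_adj G a₀ c (G.irrefl (v := i))]
  nonneg i j := by positivity

theorem sparsifier_support_le (c : Fin n × Fin n → α) :
    (sparsifier G a₀ D c).support ≤ (WGraph.ofGraph G).support := by
  intro i j hij
  change (if G.Adj i j then (1 : ℝ) else 0) ≠ 0
  by_cases h : G.Adj i j
  · simp [h]
  · refine absurd ?_ hij
    simp [sparsifier, weightNum, sample_eq_zero_of_not_adj G a₀ c h]

theorem sparsifier_numEdges_le (c : Fin n × Fin n → α) :
    (sparsifier G a₀ D c).numEdges ≤ ∑ i, sampleDeg G a₀ c i := by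
  classical
  set F := (univ : Finset (Fin n × Fin n)).filter fun e => sample G a₀ c e.1 e.2 = 1 with hF
  have h1 : (sparsifier G a₀ D c).support.edgeSet ⊆ ((F.image fun e => s(e.1, e.2)) : Set _) := by
    intro e he
    induction e with
    | _ i j =>
    rw [SimpleGraph.mem_edgeSet] at he
    simp only [coe_image, Set.mem_image, mem_coe, hF, mem_filter, mem_univ, true_and]
    refine ⟨(i, j), ?_, rfl⟩
    have h0 : sample G a₀ c i j ≠ 0 := by
      intro h
      refine he ?_
      simp [sparsifier, weightNum, h]
    have := sample_le_one G a₀ c i j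
    change sample G a₀ c i j = 1
    omega
  refine (Set.ncard_le_ncard h1 (finite_toSet _)).trans ?_
  rw [Set.ncard_coe_finset]
  refine card_image_le.trans ?_
  rw [hF, card_filter, Fintype.sum_prod_type]
  refine sum_le_sum fun i _ => sum_le_sum fun j _ => ?_
  change (if sample G a₀ c i j = 1 then 1 else 0) ≤ _
  split_ifs with h
  · exact h.ge
  · exact Nat.zero_le _

variable {G a₀ D} {c : Fin n × Fin n → α} {d l γ ε : ℝ}

/-- The constant `512 = 32 * 16` is what turns `32 d l` into at most `(d / 4)²`. -/
theorem IsGood.abs_sub_le (hc : IsGood G a₀ c d l γ) (hd0 : 0 < d) (hld : 512 * l ≤ d)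
    (v : Fin n) : |(sampleDeg G a₀ c v : ℝ) - d| ≤ d / 4 := by
  refine abs_le_of_sq_le_sq ((hc.deg v).trans ?_) (by positivity)
  nlinarith

theorem IsGood.sparsifier_w (hc : IsGood G a₀ c d l γ)
    (hd : (D : ℝ) / Fintype.card α = d) (hd0 : 0 < d) (hld : 512 * l ≤ d) (i j : Fin n) :
    (sparsifier G a₀ D c).w i j = Fintype.card α * (sample G a₀ c i j *
      (1 + ((d - sampleDeg G a₀ c i) + (d - sampleDeg G a₀ c j)) / d)) := by
  have hK : (0 : ℝ) < Fintype.card α := by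
    have : 0 < Fintype.card α := Fintype.card_pos_iff.2 ⟨a₀⟩
    exact_mod_cast this
  have hD : (D : ℝ) = d * Fintype.card α := by rw [← hd]; field_simp
  have hi := (abs_le.1 (hc.abs_sub_le hd0 hld i)).2
  have hj := (abs_le.1 (hc.abs_sub_le hd0 hld j)).2
  -- The subtraction of natural numbers in `weightNum` does not truncate, since both degrees are at
  -- most `5 d / 4`.
  have hle : Fintype.card α * (sampleDeg G a₀ c i + sampleDeg G a₀ c j) ≤ 3 * D := by
    have : (Fintype.card α : ℝ) * (sampleDeg G a₀ c i + sampleDeg G a₀ c j) ≤ 3 * D := by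
      rw [hD]
      calc (Fintype.card α : ℝ) * (sampleDeg G a₀ c i + sampleDeg G a₀ c j)
          ≤ Fintype.card α * (3 * d) := mul_le_mul_of_nonneg_left (by linarith) hK.le
        _ = _ := by ring
    exact_mod_cast this
  change (weightNum G a₀ D c i j : ℝ) / D = _
  rw [weightNum]
  push_cast [Nat.cast_sub hle]
  rw [hD]
  field_simp
  ring

theorem IsGood.sparsifier_w_bounds (hc : IsGood G a₀ c d l γ)
    (hd : (D : ℝ) / Fintype.card α = d) (hd0 : 0 < d) (hld : 512 * l ≤ d) (i j : Fin n) :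
    Fintype.card α / 2 * (sample G a₀ c i j : ℝ) ≤ (sparsifier G a₀ D c).w i j ∧
      (sparsifier G a₀ D c).w i j ≤ 3 * Fintype.card α / 2 := by
  have hi := abs_le.1 (hc.abs_sub_le hd0 hld i)
  have hj := abs_le.1 (hc.abs_sub_le hd0 hld j)
  rw [hc.sparsifier_w hd hd0 hld]
  set y := 1 + ((d - sampleDeg G a₀ c i) + (d - sampleDeg G a₀ c j)) / d with hy
  have hy1 : 1 / 2 ≤ y := by
    have : -(1 / 2) ≤ ((d - sampleDeg G a₀ c i) + (d - sampleDeg G a₀ c j)) / d := by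
      rw [le_div_iff₀ hd0]; linarith [hi.2, hj.2]
    linarith
  have hy2 : y ≤ 3 / 2 := by
    have : ((d - sampleDeg G a₀ c i) + (d - sampleDeg G a₀ c j)) / d ≤ 1 / 2 := by
      rw [div_le_iff₀ hd0]; linarith [hi.1, hj.1]
    linarith
  have hX0 : (0 : ℝ) ≤ sample G a₀ c i j := Nat.cast_nonneg _
  have hX1 : (sample G a₀ c i j : ℝ) ≤ 1 := by exact_mod_cast sample_le_one G a₀ c i j
  have hK : (0 : ℝ) ≤ Fintype.card α := Nat.cast_nonneg _
  constructor
  · calc (Fintype.card α : ℝ) / 2 * sample G a₀ c i j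
        = Fintype.card α * (sample G a₀ c i j * (1 / 2)) := by ring
      _ ≤ _ := by gcongr
  · calc (Fintype.card α : ℝ) * (sample G a₀ c i j * y) ≤ Fintype.card α * (1 * (3 / 2)) := by
          gcongr
      _ = _ := by ring

/-- The key cancellation: the corrections remove the first-order fluctuation of the degree. The
square term contributes `32 l`, the neighbours' degrees `8 l + 2`, in all at most `42 l` relative to
`d`. Uncorrected weights would leave an error of order `√(d l)`. -/
theorem IsGood.abs_wdeg_sub_le (hc : IsGood G a₀ c d l γ)
    (hd : (D : ℝ) / Fintype.card α = d) (hl : 1 ≤ l) (hld : 512 * l ≤ d) (v : Fin n) :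
    |(sparsifier G a₀ D c).wdeg v - D| ≤ 42 * l / d * D := by
  have hd0 : 0 < d := by linarith
  have hK1 : (1 : ℝ) ≤ Fintype.card α := by
    have : 0 < Fintype.card α := Fintype.card_pos_iff.2 ⟨a₀⟩
    exact_mod_cast this
  have hK : (0 : ℝ) < Fintype.card α := by linarith
  set K : ℝ := (Fintype.card α : ℝ) with hKdef
  have hD : (D : ℝ) = d * K := by rw [← hd]; field_simp
  set X : Fin n → Fin n → ℝ := fun i j => (sample G a₀ c i j : ℝ) with hX
  set δ : Fin n → ℝ := fun i => (sampleDeg G a₀ c i : ℝ) with hδ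
  have hδX : ∀ i, ∑ j, X i j = δ i := by
    intro i; simp only [hX, hδ, sampleDeg]; push_cast; rfl
  set Z := ∑ u, X v u * ∑ w, (if w = v then 0 else X u w) with hZ
  have hnbr : |Z - δ v * (d - 1 / K)| ≤ 8 * d * l := hc.nbr v
  -- The degree of every sampled neighbour includes the edge back to `v`; these edges contribute `δ
  -- v` in all, and the rest is independent of the edges at `v`.
  have hsum : ∑ u, X v u * δ u = Z + δ v := by
    rw [← hδX v, hZ, ← sum_add_distrib]
    refine sum_congr rfl fun u _ => ?_
    rw [← hδX u, ← add_sum_erase univ (fun j => X u j) (mem_univ v),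
      ← add_sum_erase univ (fun w => if w = v then 0 else X u w) (mem_univ v)]
    have e1 : X v u * X u v = X v u := by
      simp only [hX, sample_comm G a₀ c u v]
      have := sample_le_one G a₀ c v u
      interval_cases sample G a₀ c v u <;> simp
    have e2 : ∑ w ∈ univ.erase v, (if w = v then 0 else X u w) = ∑ w ∈ univ.erase v, X u w :=
      sum_congr rfl fun w hw => if_neg (ne_of_mem_erase hw)
    rw [e2, if_pos rfl, mul_add, e1]
    ring
  have hwd : (sparsifier G a₀ D c).wdeg v =
      K * (d - (δ v - d) ^ 2 / d + (δ v * d - δ v - Z) / d) := by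
    have e : (sparsifier G a₀ D c).wdeg v =
        ∑ u, K * ((1 + (2 * d - δ v) / d) * X v u - 1 / d * (X v u * δ u)) := by
      refine sum_congr rfl fun u _ => ?_
      rw [hc.sparsifier_w hd hd0 hld]
      simp only [hX, hδ]
      field_simp
      ring
    rw [e, ← mul_sum, sum_sub_distrib, ← mul_sum, ← mul_sum, hδX, hsum]
    field_simp
    ring
  have hT : |δ v * d - δ v - Z| ≤ 8 * d * l + 2 * d := by
    have h1 := abs_le.1 hnbr
    have h2 := (abs_le.1 (hc.abs_sub_le hd0 hld v)).2
    have h3 : 0 ≤ δ v := Nat.cast_nonneg _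
    have h4 : 0 ≤ δ v * (1 / K) := by positivity
    have h5 : δ v * (1 / K) ≤ δ v :=
      mul_le_of_le_one_right h3 (by rw [div_le_one hK]; exact hK1)
    have h6 : δ v ≤ 2 * d := by simp only [hδ]; linarith
    rw [abs_le]
    constructor <;> linarith [h1.1, h1.2]
  have hb : (δ v - d) ^ 2 / d ≤ 32 * l := by
    rw [div_le_iff₀ hd0]
    linarith [hc.deg v]
  have hb0 : 0 ≤ (δ v - d) ^ 2 / d := by positivity
  have hT' : |(δ v * d - δ v - Z) / d| ≤ 8 * l + 2 := by
    rw [abs_div, abs_of_pos hd0, div_le_iff₀ hd0]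
    linarith
  have e : (sparsifier G a₀ D c).wdeg v - D =
      K * (-((δ v - d) ^ 2 / d) + (δ v * d - δ v - Z) / d) := by rw [hwd, hD]; ring
  rw [e, abs_mul, abs_of_pos hK, hD]
  calc K * |-((δ v - d) ^ 2 / d) + (δ v * d - δ v - Z) / d| ≤ K * (42 * l) := by
        refine mul_le_mul_of_nonneg_left ?_ hK.le
        have h1 := abs_le.1 hT'
        rw [abs_le]
        constructor <;> linarith [h1.1, h1.2]
    _ = 42 * l / d * (d * K) := by field_simp

/-- A kept edge has weight at least `K / 2` and a sampled cut keeps half of `γ d |S|`; two factors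
`1 / 2` and `K d = D` give `γ D / 4`. -/
theorem IsGood.expands (hc : IsGood G a₀ c d l γ)
    (hd : (D : ℝ) / Fintype.card α = d) (hd0 : 0 < d) (hld : 512 * l ≤ d) :
    (sparsifier G a₀ D c).Expands (γ * D / 4) := by
  intro S hS hS'
  have hK : (0 : ℝ) < Fintype.card α := by
    have : 0 < Fintype.card α := Fintype.card_pos_iff.2 ⟨a₀⟩
    exact_mod_cast this
  have hD : (D : ℝ) = d * Fintype.card α := by rw [← hd]; field_simp
  have h1 := hc.cut S hS (by simpa using hS')
  calc γ * D / 4 * S.card = Fintype.card α / 2 * (γ * d * S.card / 2) := by rw [hD]; ring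
    _ ≤ Fintype.card α / 2 * ∑ u ∈ S, ∑ v ∈ Sᶜ, (sample G a₀ c u v : ℝ) := by gcongr
    _ = ∑ u ∈ S, ∑ v ∈ Sᶜ, Fintype.card α / 2 * (sample G a₀ c u v : ℝ) := by
        simp only [mul_sum]
    _ ≤ _ := sum_le_sum fun u _ => sum_le_sum fun v _ =>
        (hc.sparsifier_w_bounds hd hd0 hld u v).1

/-- Both graphs have all resistances near `2 / D`. The relative errors are `(4 + 8 / γ²) / D` for
the graph and `(84 l + 6 + 384 / γ²) / d` for the sparsifier, both at most `ε / 8` by `hεd`. -/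
theorem IsGood.isResistanceSparsifier (hc : IsGood G a₀ c d l γ) (hG : G.IsRegularOfDegree D)
    (hd : (D : ℝ) / Fintype.card α = d) (hexp : (WGraph.ofGraph G).Expands (γ * D))
    (hγ : 0 < γ) (hl : 1 ≤ l) (hld : 512 * l ≤ d) (hε : 0 ≤ ε) (hε1 : ε ≤ 1)
    (hεd : 8 * (90 * l + 384 / γ ^ 2) ≤ ε * d) :
    (WGraph.ofGraph G).IsResistanceSparsifier (sparsifier G a₀ D c) ε := by
  have hd0 : 0 < d := by linarith
  have hK1 : (1 : ℝ) ≤ Fintype.card α := by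
    have : 0 < Fintype.card α := Fintype.card_pos_iff.2 ⟨a₀⟩
    exact_mod_cast this
  have hK : (0 : ℝ) < Fintype.card α := by linarith
  have hD : (D : ℝ) = d * Fintype.card α := by rw [← hd]; field_simp
  have hdD : d ≤ D := by rw [hD]; nlinarith
  have hD0 : (0 : ℝ) < D := by linarith
  have hγD : 0 < γ * D := by positivity
  refine isResistanceSparsifier_of_abs_le (r := 2 / D) (by positivity) hε hε1
    (sparsifier_support_le G a₀ D c) (fun u v huv => ?_) (fun u v huv => ?_)
  · have hgap := hexp.hasGap hγD (fun u => (WGraph.ofGraph_wdeg G hG u).le) hD0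
    have h := (WGraph.ofGraph G).abs_resistance_sub_le (D := D) (W := 1) (η := 0)
      (by positivity) hgap hD0 (by norm_num) (fun u => by rw [WGraph.ofGraph_wdeg G hG]; simp)
      (fun u v => by
        change (if G.Adj u v then (1 : ℝ) else 0) ≤ 1
        split_ifs <;> norm_num) huv
    refine h.trans (mul_le_mul_of_nonneg_left ?_ (by positivity))
    have e : 2 * (0 : ℝ) + 4 * 1 / D + 4 * 1 / ((γ * D) ^ 2 / (2 * D)) = (4 + 8 / γ ^ 2) / D := by
      field_simp
      ring
    rw [e, div_le_iff₀ hD0]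
    have h1 : ε * d ≤ ε * D := mul_le_mul_of_nonneg_left hdD hε
    have h2 : 8 / γ ^ 2 ≤ 384 / γ ^ 2 := div_le_div_of_nonneg_right (by norm_num) (by positivity)
    linarith
  · have hη : 42 * l / d ≤ 1 / 2 := by
      rw [div_le_iff₀ hd0]; linarith
    have hdeg := hc.abs_wdeg_sub_le hd hl hld
    -- The weighted degrees are at most `3 D / 2`; the rounder bound `2 D` gives the gap `γ² D /
    -- 64`.
    have hgap := (hc.expands hd hd0 hld).hasGap (Δ := 2 * D) (by positivity) (fun u => by
      have := (abs_le.1 (hdeg u)).2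
      nlinarith) (by positivity)
    have h := (sparsifier G a₀ D c).abs_resistance_sub_le (D := D) (η := 42 * l / d)
      (by positivity) hgap hD0 hη hdeg
      (fun u v => (hc.sparsifier_w_bounds hd hd0 hld u v).2) huv
    refine h.trans (mul_le_mul_of_nonneg_left ?_ (by positivity))
    have e : 2 * (42 * l / d) + 4 * (3 * (Fintype.card α : ℝ) / 2) / D +
        4 * (3 * (Fintype.card α : ℝ) / 2) / ((γ * D / 4) ^ 2 / (2 * (2 * D))) =
        (84 * l + 6 + 384 / γ ^ 2) / d := by
      rw [hD]
      field_simp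
      ring
    rw [e, div_le_iff₀ hd0]
    linarith

theorem IsGood.numEdges_le (hc : IsGood G a₀ c d l γ) (hd0 : 0 < d) (hld : 512 * l ≤ d) :
    ((sparsifier G a₀ D c).numEdges : ℝ) ≤ 2 * n * d := by
  calc ((sparsifier G a₀ D c).numEdges : ℝ) ≤ ∑ i, (sampleDeg G a₀ c i : ℝ) := by
        exact_mod_cast sparsifier_numEdges_le G a₀ D c
    _ ≤ ∑ _i : Fin n, 2 * d := sum_le_sum fun i _ => by
        linarith [(abs_le.1 (hc.abs_sub_le hd0 hld i)).2]
    _ = 2 * n * d := by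
        rw [sum_const, card_univ, Fintype.card_fin, nsmul_eq_mul]; ring

end Sparsifier

end ResSparse

namespace ResSparse

open Finset

/-! ### Program logic -/

/-- The program halts within `T` steps in a state that satisfies `Q`. -/
def Runs (ω : ℕ → Bool) (p : Prog) (s : State) (T : ℕ) (Q : State → Prop) : Prop :=
  ∃ t ≤ T, ∃ s', Exec ω p s t s' ∧ Q s'

/-- The memory `m'` agrees with `m` outside the arrays in `A`. -/
def Frame (A : Finset ℕ) (m m' : Memory) : Prop := ∀ a ∉ A, m' a = m a

theorem Memory.write_of_ne (m : Memory) {a a' : ℕ} (i j x : ℕ) (h : a' ≠ a) :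
    m.write a i j x a' = m a' := by
  funext i' j'
  simp [Memory.write, h]

theorem Memory.write_self (m : Memory) (a i j x : ℕ) : m.write a i j x a i j = x := by
  simp [Memory.write]

theorem Memory.write_apply (m : Memory) (a i j x i' j' : ℕ) :
    m.write a i j x a i' j' = if i' = i ∧ j' = j then x else m a i' j' := by
  simp [Memory.write]

theorem Frame.refl (A : Finset ℕ) (m : Memory) : Frame A m m := fun _ _ => rfl

theorem Frame.trans {A : Finset ℕ} {m m' m'' : Memory} (h : Frame A m m') (h' : Frame A m' m'') :
    Frame A m m'' := fun a ha => (h' a ha).trans (h a ha)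

theorem Frame.mono {A B : Finset ℕ} {m m' : Memory} (h : Frame A m m') (hAB : A ⊆ B) :
    Frame B m m' := fun a ha => h a fun h' => ha (hAB h')

theorem Frame.write {A : Finset ℕ} {m m' : Memory} (h : Frame A m m') {a : ℕ} (ha : a ∈ A)
    (i j x : ℕ) : Frame A m (m'.write a i j x) := fun b hb => by
  have hne : b ≠ a := by rintro rfl; exact hb ha
  rw [Memory.write_of_ne _ _ _ _ hne, h b hb]

/-- The scalar variable stored in cell `(0, 0)` of an array. -/
def var (a : ℕ) : Expr := .read a (.const 0) (.const 0)

/-- Assignment to a scalar variable. -/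
def setVar (a : ℕ) (e : Expr) : Prog := .assign a (.const 0) (.const 0) e

@[simp] theorem eval_var (m : Memory) (a : ℕ) : (var a).eval m = m a 0 0 := rfl

@[simp] theorem eval_const (m : Memory) (k : ℕ) : (Expr.const k).eval m = k := rfl

@[simp] theorem eval_read (m : Memory) (a : ℕ) (i j : Expr) :
    (Expr.read a i j).eval m = m a (i.eval m) (j.eval m) := rfl

@[simp] theorem eval_add (m : Memory) (e f : Expr) : (e.add f).eval m = e.eval m + f.eval m := rfl

@[simp] theorem eval_sub (m : Memory) (e f : Expr) : (e.sub f).eval m = e.eval m - f.eval m := rfl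

section Rules

variable {ω : ℕ → Bool} {s : State} {Q R : State → Prop}

theorem Runs.mono {p : Prog} {T T' : ℕ} (h : Runs ω p s T Q) (hT : T ≤ T')
    (hQ : ∀ s', Q s' → R s') : Runs ω p s T' R := by
  obtain ⟨t, ht, s', he, hq⟩ := h
  exact ⟨t, ht.trans hT, s', he, hQ s' hq⟩

theorem Runs.of_le {p : Prog} {T T' : ℕ} (h : Runs ω p s T Q) (hT : T ≤ T') : Runs ω p s T' Q :=
  h.mono hT fun _ h => h

theorem Runs.skip (h : Q s) : Runs ω .skip s 1 Q := ⟨1, le_rfl, s, .skip s, h⟩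

theorem Runs.assign {a : ℕ} {i j e : Expr}
    (h : Q ⟨s.mem.write a (i.eval s.mem) (j.eval s.mem) (e.eval s.mem), s.pos⟩) :
    Runs ω (.assign a i j e) s 1 Q := ⟨1, le_rfl, _, .assign a i j e s, h⟩

theorem Runs.setVar {a : ℕ} {e : Expr} (h : Q ⟨s.mem.write a 0 0 (e.eval s.mem), s.pos⟩) :
    Runs ω (setVar a e) s 1 Q := Runs.assign h

theorem Runs.toss {a : ℕ} {i j : Expr}
    (h : Q ⟨s.mem.write a (i.eval s.mem) (j.eval s.mem) (if ω s.pos then 1 else 0), s.pos + 1⟩) :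
    Runs ω (.toss a i j) s 1 Q := ⟨1, le_rfl, _, .toss a i j s, h⟩

theorem Runs.seq {p q : Prog} {T₁ T₂ : ℕ} (h : Runs ω p s T₁ fun s' => Runs ω q s' T₂ Q) :
    Runs ω (.seq p q) s (T₁ + T₂) Q := by
  obtain ⟨t, ht, s', he, t', ht', s'', he', hq⟩ := h
  exact ⟨t + t', add_le_add ht ht', s'', .seq he he', hq⟩

theorem Runs.ite {c : Expr} {p q : Prog} {T : ℕ} (h₁ : c.eval s.mem ≠ 0 → Runs ω p s T Q)
    (h₂ : c.eval s.mem = 0 → Runs ω q s T Q) : Runs ω (.ite c p q) s (T + 1) Q := by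
  by_cases hc : c.eval s.mem = 0
  · obtain ⟨t, ht, s', he, hq⟩ := h₂ hc
    exact ⟨t + 1, by omega, s', .ite_neg hc he, hq⟩
  · obtain ⟨t, ht, s', he, hq⟩ := h₁ hc
    exact ⟨t + 1, by omega, s', .ite_pos hc he, hq⟩

/-- The invariant is indexed by the number of completed iterations and must force the guard to fail
exactly at `N`. Each guard evaluation costs one step, including the final one. -/
theorem Runs.loop {c : Expr} {p : Prog} {B N : ℕ} (I : ℕ → State → Prop)
    (hs : I 0 s) (hstep : ∀ i s, i < N → I i s → c.eval s.mem ≠ 0 ∧ Runs ω p s B (I (i + 1)))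
    (hend : ∀ s, I N s → c.eval s.mem = 0) : Runs ω (.loop c p) s (N * (B + 1) + 1) (I N) := by
  have key : ∀ r i s, i + r = N → I i s → Runs ω (.loop c p) s (r * (B + 1) + 1) (I N) := by
    intro r
    induction r with
    | zero =>
      intro i s hi hI
      obtain rfl : i = N := by omega
      exact ⟨1, by omega, s, .loop_done (hend s hI), hI⟩
    | succ r ih =>
      intro i s hi hI
      obtain ⟨hc, t, ht, s', he, hI'⟩ := hstep i s (by omega) hI
      obtain ⟨t', ht', s'', he', hI''⟩ := ih (i + 1) s' (by omega) hI'
      refine ⟨t + t' + 1, ?_, s'', .loop_step hc he he', hI''⟩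
      rw [Nat.succ_mul]
      omega
  exact key N 0 s (by omega) hs

/-- Run the body for `v = 0, 1, …` as long as `v` is less than the bound. -/
def forLoop (v : ℕ) (bound : Expr) (body : Prog) : Prog :=
  .seq (ResSparse.setVar v (.const 0))
    (.loop (.sub bound (var v)) (.seq body (ResSparse.setVar v (.add (var v) (.const 1)))))

theorem Runs.forLoop {v : ℕ} {bound : Expr} {body : Prog} {B N : ℕ} (I : ℕ → State → Prop)
    (hs : I 0 ⟨s.mem.write v 0 0 0, s.pos⟩)
    (hv : ∀ i s, I i s → s.mem v 0 0 = i ∧ bound.eval s.mem = N)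
    (hstep : ∀ i s, i < N → I i s → Runs ω body s B fun s' =>
      s'.mem v 0 0 = i ∧ I (i + 1) ⟨s'.mem.write v 0 0 (i + 1), s'.pos⟩) :
    Runs ω (forLoop v bound body) s (N * (B + 2) + 2) (I N) := by
  have h : Runs ω (ResSparse.forLoop v bound body) s (1 + (N * (B + 1 + 1) + 1)) (I N) := by
    refine Runs.seq (Runs.setVar (Runs.loop I hs (fun i s hi hI => ?_) fun s hI => ?_))
    · obtain ⟨h1, h2⟩ := hv i s hI
      refine ⟨?_, Runs.seq ((hstep i s hi hI).mono le_rfl fun s' hs' => Runs.setVar ?_)⟩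
      · rw [eval_sub, eval_var, h1, h2]
        omega
      · rw [eval_add, eval_var, hs'.1]
        exact hs'.2
    · obtain ⟨h1, h2⟩ := hv N s hI
      rw [eval_sub, eval_var, h1, h2, Nat.sub_self]
  exact h.of_le (by ring_nf; omega)

/-- Multiplication by repeated addition. -/
def mulProg (dst cnt : ℕ) (e f : Expr) : Prog :=
  .seq (ResSparse.setVar dst (.const 0))
    (ResSparse.forLoop cnt e (ResSparse.setVar dst (.add (var dst) f)))

/-- Both factors are re-evaluated in every round, hence they must be stable under changes of the two
work arrays. The time depends on the first factor only, so large numbers such as `p` and `q` go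
second. -/
theorem Runs.mulProg {dst cnt : ℕ} {e f : Expr} (hne : dst ≠ cnt) {x y : ℕ}
    (he : ∀ m, Frame {dst, cnt} s.mem m → e.eval m = x)
    (hf : ∀ m, Frame {dst, cnt} s.mem m → f.eval m = y)
    (h : ∀ s', Frame {dst, cnt} s.mem s'.mem → s'.pos = s.pos → s'.mem dst 0 0 = x * y → Q s') :
    Runs ω (mulProg dst cnt e f) s (3 * x + 3) Q := by
  have hd : dst ∈ ({dst, cnt} : Finset ℕ) := by simp
  have hc : cnt ∈ ({dst, cnt} : Finset ℕ) := by simp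
  have h1 : Runs ω (ResSparse.mulProg dst cnt e f) s (1 + (x * (1 + 2) + 2)) Q := by
    refine Runs.seq (Runs.setVar ((Runs.forLoop (N := x) (B := 1)
      (fun i s' => Frame {dst, cnt} s.mem s'.mem ∧ s'.pos = s.pos ∧ s'.mem cnt 0 0 = i ∧
        s'.mem dst 0 0 = i * y) ?_ ?_ ?_).mono le_rfl fun s' hs' => h s' hs'.1 hs'.2.1 hs'.2.2.2))
    · refine ⟨((Frame.refl _ _).write hd _ _ _).write hc _ _ _, rfl, Memory.write_self .., ?_⟩
      dsimp only
      rw [Memory.write_of_ne _ _ _ _ hne, Memory.write_self]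
      simp
    · rintro i s' ⟨hF, -, h2, -⟩
      exact ⟨h2, he _ hF⟩
    · rintro i s' - ⟨hF, h2, h3, h4⟩
      refine Runs.setVar ⟨?_, (hF.write hd _ _ _).write hc _ _ _, h2, Memory.write_self .., ?_⟩
      · dsimp only
        rw [Memory.write_of_ne _ _ _ _ hne.symm, h3]
      · dsimp only
        rw [Memory.write_of_ne _ _ _ _ hne, Memory.write_self, eval_add, eval_var, h4, hf _ hF,
          Nat.succ_mul]
  exact h1.of_le (by omega)

end Rules

end ResSparse

namespace ResSparse

open Finset

/-! ### The algorithm -/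

/-- Array `3` receives the degree of vertex `0`. -/
def degreeProg : Prog :=
  .seq (setVar 3 (.const 0))
    (forLoop 5 (var 0) (setVar 3 (.add (var 3) (.read 1 (.const 0) (var 5)))))

/-- Array `7` receives the number of binary digits of `n`. -/
def sizeProg : Prog :=
  .seq (setVar 7 (.const 0)) (.seq (setVar 8 (.const 1))
    -- Truncated subtraction as comparison: the guard is nonzero exactly when variable `8` is at
    -- most `n`.
    (.loop (.sub (.add (var 0) (.const 1)) (var 8))
      (.seq (setVar 8 (.add (var 8) (var 8))) (setVar 7 (.add (var 7) (.const 1))))))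

/-- Array `12` receives the largest `k` such that `2 ^ k` times the content of array `10` is at most
the content of array `11`, and array `13` receives `2 ^ k`. -/
def rateProg : Prog :=
  .seq (setVar 12 (.const 0)) (.seq (setVar 13 (.const 1))
    -- The guard tests whether one more doubling still fits below variable `11`.
    (.loop (.sub (.add (var 11) (.const 1)) (.add (var 10) (var 10)))
      (.seq (setVar 10 (.add (var 10) (var 10)))
        (.seq (setVar 13 (.add (var 13) (var 13))) (setVar 12 (.add (var 12) (.const 1)))))))

/-- Every pair `j < i` of adjacent vertices is kept in array `16` if `k` coins all show `1`. -/
def sampleProg : Prog :=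
  forLoop 4 (var 0) (forLoop 5 (var 0)
    (.seq (.ite (.sub (var 4) (var 5)) (setVar 14 (.read 1 (var 4) (var 5)))
        (setVar 14 (.const 0)))
      -- Coins are tossed for every ordered pair, relevant or not, so the position of a coin is an
      -- explicit function of the pair.
      (.seq (forLoop 6 (var 12)
          (.seq (.toss 15 (.const 0) (.const 0)) (.ite (var 15) .skip (setVar 14 (.const 0)))))
        (.assign 16 (var 4) (var 5) (var 14)))))

/-- Is the pair given by the variables `4` and `5` an edge of the sampled graph? -/
def isSampled : Expr := .add (.read 16 (var 4) (var 5)) (.read 16 (var 5) (var 4))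

/-- Array `17` receives the degrees of the sampled graph, scaled by `2 ^ k`. -/
def scaledDegreeProg : Prog :=
  forLoop 4 (var 0) (.seq (.assign 17 (var 4) (.const 0) (.const 0))
    (forLoop 5 (var 0) (.ite isSampled
      (.assign 17 (var 4) (.const 0) (.add (.read 17 (var 4) (.const 0)) (var 13))) .skip)))

/-- The weights are written to the output. -/
def weightProg : Prog :=
  forLoop 4 (var 0) (forLoop 5 (var 0) (.ite isSampled
    (.seq (mulProg 14 6 (var 13) (.sub (.add (var 3) (.add (var 3) (var 3)))
        (.add (.read 17 (var 4) (.const 0)) (.read 17 (var 5) (.const 0)))))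
      (.assign 2 (var 4) (var 5) (var 14)))
    (.assign 2 (var 4) (var 5) (.const 0))))

/-- The whole algorithm. -/
def sparsifyProg : Prog :=
  -- With `l = Nat.size n`, arrays `10` and `11` hold `l² q` and `D p`, so the rate found is the
  -- largest `k` with `2 ^ k * l² ≤ D * (p / q)`, without any division.
  .seq degreeProg (.seq sizeProg (.seq (mulProg 9 6 (var 7) (var 7))
    (.seq (mulProg 10 6 (var 9) (.read 0 (.const 0) (.const 2)))
      (.seq (mulProg 11 6 (var 3) (.read 0 (.const 0) (.const 1)))
        (.seq rateProg (.seq sampleProg (.seq scaledDegreeProg weightProg)))))))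

/-! ### Correctness and running time of the subprograms. -/

section Specifications

variable {ω : ℕ → Bool} {s : State} {Q : State → Prop} {n : ℕ}

theorem runs_degreeProg (hn : s.mem 0 0 0 = n)
    (h : ∀ s', Frame {3, 5} s.mem s'.mem → s'.pos = s.pos →
      s'.mem 3 0 0 = ∑ j ∈ range n, s.mem 1 0 j → Q s') :
    Runs ω degreeProg s (3 * n + 3) Q := by
  have h1 : Runs ω degreeProg s (1 + (n * (1 + 2) + 2)) Q := by
    refine Runs.seq (Runs.setVar ((Runs.forLoop (N := n) (B := 1)
      (fun i s' => Frame {3, 5} s.mem s'.mem ∧ s'.pos = s.pos ∧ s'.mem 5 0 0 = i ∧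
        s'.mem 3 0 0 = ∑ j ∈ range i, s.mem 1 0 j) ?_ ?_ ?_).mono le_rfl
        fun s' hs' => h s' hs'.1 hs'.2.1 hs'.2.2.2))
    · refine ⟨((Frame.refl _ _).write (by decide) _ _ _).write (by decide) _ _ _, rfl,
        by simp [Memory.write], ?_⟩
      simp [Memory.write]
    · rintro i s' ⟨hF, -, h2, -⟩
      exact ⟨h2, by rw [eval_var, hF 0 (by decide), hn]⟩
    · rintro i s' - ⟨hF, h2, h3, h4⟩
      refine Runs.setVar ⟨?_, (hF.write (by decide) _ _ _).write (by decide) _ _ _, h2,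
        by simp [Memory.write], ?_⟩
      · simp [Memory.write, h3]
      · rw [sum_range_succ, ← h4]
        simp [Memory.write, h3, hF 1 (by decide)]
  exact h1.of_le (by omega)

theorem runs_sizeProg (hn : s.mem 0 0 0 = n)
    (h : ∀ s', Frame {7, 8} s.mem s'.mem → s'.pos = s.pos → s'.mem 7 0 0 = Nat.size n → Q s') :
    Runs ω sizeProg s (3 * Nat.size n + 3) Q := by
  have h1 : Runs ω sizeProg s (1 + (1 + (Nat.size n * (1 + 1 + 1) + 1))) Q := by
    refine Runs.seq (Runs.setVar (Runs.seq (Runs.setVar ((Runs.loop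
      (fun i s' => Frame {7, 8} s.mem s'.mem ∧ s'.pos = s.pos ∧ s'.mem 8 0 0 = 2 ^ i ∧
        s'.mem 7 0 0 = i) ?_ ?_ ?_).mono le_rfl fun s' hs' => h s' hs'.1 hs'.2.1 hs'.2.2.2))))
    · refine ⟨((Frame.refl _ _).write (by decide) _ _ _).write (by decide) _ _ _, rfl, ?_, ?_⟩ <;>
      simp [Memory.write]
    · rintro i s' hi ⟨hF, h2, h3, h4⟩
      refine ⟨?_, Runs.seq (Runs.setVar (Runs.setVar
        ⟨(hF.write (by decide) _ _ _).write (by decide) _ _ _, h2, ?_, ?_⟩))⟩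
      · have := Nat.lt_size.1 hi
        simp only [eval_sub, eval_add, eval_var, eval_const, h3, hF 0 (by decide), hn]
        omega
      · simp [Memory.write, h3, pow_succ, mul_two]
      · simp [Memory.write, h4]
    · rintro s' ⟨hF, h2, h3, h4⟩
      have := Nat.lt_size_self n
      simp only [eval_sub, eval_add, eval_var, eval_const, h3, hF 0 (by decide), hn]
      omega
  exact h1.of_le (by omega)

theorem runs_rateProg {a b k : ℕ} (ha : s.mem 10 0 0 = a) (hb : s.mem 11 0 0 = b)
    (hk : 2 ^ k * a ≤ b) (hk' : b < 2 ^ (k + 1) * a)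
    (h : ∀ s', Frame {10, 12, 13} s.mem s'.mem → s'.pos = s.pos → s'.mem 12 0 0 = k →
      s'.mem 13 0 0 = 2 ^ k → Q s') :
    Runs ω rateProg s (4 * k + 3) Q := by
  have h1 : Runs ω rateProg s (1 + (1 + (k * (1 + (1 + 1) + 1) + 1))) Q := by
    refine Runs.seq (Runs.setVar (Runs.seq (Runs.setVar ((Runs.loop
      (fun i s' => Frame {10, 12, 13} s.mem s'.mem ∧ s'.pos = s.pos ∧ s'.mem 10 0 0 = 2 ^ i * a ∧
        s'.mem 12 0 0 = i ∧ s'.mem 13 0 0 = 2 ^ i) ?_ ?_ ?_).mono le_rfl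
          fun s' hs' => h s' hs'.1 hs'.2.1 hs'.2.2.2.1 hs'.2.2.2.2))))
    · refine ⟨((Frame.refl _ _).write (by decide) _ _ _).write (by decide) _ _ _, rfl, ?_, ?_, ?_⟩
        <;> simp [Memory.write, ha]
    · rintro i s' hi ⟨hF, h2, h3, h4, h5⟩
      refine ⟨?_, Runs.seq (Runs.setVar (Runs.seq (Runs.setVar (Runs.setVar
        ⟨((hF.write (by decide) _ _ _).write (by decide) _ _ _).write (by decide) _ _ _,
          h2, ?_, ?_, ?_⟩))))⟩
      · have h6 : 2 ^ (i + 1) * a ≤ 2 ^ k * a :=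
          Nat.mul_le_mul_right _ (Nat.pow_le_pow_right (by norm_num) hi)
        rw [pow_succ] at h6
        simp only [eval_sub, eval_add, eval_var, eval_const, h3, hF 11 (by decide), hb]
        have h7 : 2 ^ i * a + 2 ^ i * a = 2 ^ i * 2 * a := by ring
        omega
      · simp [Memory.write, h3]; ring
      · simp [Memory.write, h4]
      · simp [Memory.write, h5]; ring
    · rintro s' ⟨hF, h2, h3, h4, h5⟩
      rw [pow_succ] at hk'
      simp only [eval_sub, eval_add, eval_var, eval_const, h3, hF 11 (by decide), hb]
      have h7 : 2 ^ k * a + 2 ^ k * a = 2 ^ k * 2 * a := by ring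
      omega
  exact h1.of_le (by omega)

open Classical in
/-- The content of cell `(i, j)` of array `16` after the sampling, if `adj` is the adjacency
matrix. -/
noncomputable def keepCell (ω : ℕ → Bool) (adj : ℕ → ℕ → ℕ) (n k i j : ℕ) : ℕ :=
  if j < i ∧ ∀ t < k, ω ((i * n + j) * k + t) = true then adj i j else 0

-- One pair consumes exactly `k` coins whatever the outcome, which carries the invariant on the coin
-- position to the next pair.
open Classical in
theorem runs_keep {k i j : ℕ} (hi : s.mem 4 0 0 = i) (hj : s.mem 5 0 0 = j)
    (hk : s.mem 12 0 0 = k) (hpos : s.pos = (i * n + j) * k)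
    (h : ∀ s', Frame {6, 14, 15, 16} s.mem s'.mem → s'.pos = (i * n + (j + 1)) * k →
      s'.mem 16 = (s.mem.write 16 i j (keepCell ω (s.mem 1) n k i j)) 16 → Q s') :
    Runs ω (.seq (.ite (.sub (var 4) (var 5)) (setVar 14 (.read 1 (var 4) (var 5)))
        (setVar 14 (.const 0)))
      (.seq (forLoop 6 (var 12)
          (.seq (.toss 15 (.const 0) (.const 0)) (.ite (var 15) .skip (setVar 14 (.const 0)))))
        (.assign 16 (var 4) (var 5) (var 14)))) s (5 * k + 5) Q := by
  set b₀ : ℕ := if j < i then s.mem 1 i j else 0 with hb₀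
  have h1 : Runs ω (.seq (.ite (.sub (var 4) (var 5)) (setVar 14 (.read 1 (var 4) (var 5)))
        (setVar 14 (.const 0)))
      (.seq (forLoop 6 (var 12)
          (.seq (.toss 15 (.const 0) (.const 0)) (.ite (var 15) .skip (setVar 14 (.const 0)))))
        (.assign 16 (var 4) (var 5) (var 14)))) s
      (1 + 1 + (k * (1 + (1 + 1) + 2) + 2 + 1)) Q := by
    have main : ∀ s₁ : State, Frame {6, 14, 15} s.mem s₁.mem → s₁.pos = s.pos →
        s₁.mem 14 0 0 = b₀ → Runs ω (.seq (forLoop 6 (var 12)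
          (.seq (.toss 15 (.const 0) (.const 0)) (.ite (var 15) .skip (setVar 14 (.const 0)))))
        (.assign 16 (var 4) (var 5) (var 14))) s₁ (k * (1 + (1 + 1) + 2) + 2 + 1) Q := by
      intro s₁ hF₁ hpos₁ hb₁
      refine Runs.seq ((Runs.forLoop (N := k)
        (fun t s' => Frame {6, 14, 15} s.mem s'.mem ∧ s'.pos = (i * n + j) * k + t ∧
          s'.mem 6 0 0 = t ∧ s'.mem 14 0 0 =
            if ∀ t' < t, ω ((i * n + j) * k + t') = true then b₀ else 0) ?_ ?_ ?_).mono le_rfl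
        ?_)
      · refine ⟨hF₁.write (by decide) _ _ _, by simp [hpos₁, hpos], by simp [Memory.write], ?_⟩
        simp [Memory.write, hb₁]
      · rintro t s' ⟨hF, -, h3, -⟩
        exact ⟨h3, by rw [eval_var, hF 12 (by decide), hk]⟩
      · rintro t s' ht ⟨hF, h2, h3, h4⟩
        refine Runs.seq (Runs.toss (Runs.ite (fun hc => Runs.skip ?_) (fun hc => Runs.setVar ?_)))
        · have hω : ω ((i * n + j) * k + t) = true := by
            by_contra hcon
            simp [Memory.write, h2, hcon] at hc
          refine ⟨by simp [Memory.write, h3],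
            (hF.write (by decide) _ _ _).write (by decide) _ _ _, ?_, by simp [Memory.write], ?_⟩
          · simp [h2, add_assoc]
          · simp only [Nat.forall_lt_succ_right, hω, and_true]
            simp [Memory.write, h4]
        · have hω : ω ((i * n + j) * k + t) = false := by
            by_contra hcon
            simp [Memory.write, h2, hcon] at hc
          refine ⟨by simp [Memory.write, h3],
            ((hF.write (by decide) _ _ _).write (by decide) _ _ _).write (by decide) _ _ _, ?_,
            by simp [Memory.write], ?_⟩
          · simp [h2, add_assoc]
          · simp only [Nat.forall_lt_succ_right, hω]
            simp [Memory.write]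
      · rintro s' ⟨hF, h2, h3, h4⟩
        refine Runs.assign (h _ ((hF.mono (by decide)).write (by decide) _ _ _) ?_ ?_)
        · simp only [h2]; ring
        · simp only [eval_var, hF 4 (by decide), hF 5 (by decide), hi, hj, h4]
          funext i' j'
          rw [Memory.write_apply, Memory.write_apply, hF 16 (by decide)]
          have : (if ∀ t' < k, ω ((i * n + j) * k + t') = true then b₀ else 0) =
              keepCell ω (s.mem 1) n k i j := by
            rw [hb₀, keepCell]
            by_cases hA : ∀ t' < k, ω ((i * n + j) * k + t') = true <;> by_cases hB : j < i <;>
              simp [hA, hB]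
          rw [this]
    refine Runs.seq (Runs.ite (fun hc => Runs.setVar ?_) (fun hc => Runs.setVar ?_))
    · have hji : j < i := by
        simp only [eval_sub, eval_var, hi, hj] at hc
        omega
      refine main _ ((Frame.refl _ _).write (by decide) _ _ _) rfl ?_
      simp [Memory.write, hi, hj, hb₀, hji]
    · have hji : ¬ j < i := by
        simp only [eval_sub, eval_var, hi, hj] at hc
        omega
      refine main _ ((Frame.refl _ _).write (by decide) _ _ _) rfl ?_
      simp [Memory.write, hb₀, hji]
  exact h1.of_le (by omega)

theorem runs_sampleProg {k : ℕ} (hn : s.mem 0 0 0 = n) (hk : s.mem 12 0 0 = k) (hpos : s.pos = 0)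
    (h : ∀ s', Frame {4, 5, 6, 14, 15, 16} s.mem s'.mem →
      (∀ i < n, ∀ j < n, s'.mem 16 i j = keepCell ω (s.mem 1) n k i j) → Q s') :
    Runs ω sampleProg s (n * (n * (5 * k + 5 + 2) + 2 + 2) + 2) Q := by
  refine (Runs.forLoop (N := n) (B := n * (5 * k + 5 + 2) + 2)
    (fun i s' => Frame {4, 5, 6, 14, 15, 16} s.mem s'.mem ∧ s'.pos = (i * n) * k ∧
      s'.mem 4 0 0 = i ∧ ∀ i' < i, ∀ j' < n, s'.mem 16 i' j' = keepCell ω (s.mem 1) n k i' j')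
    ?_ ?_ ?_).mono le_rfl fun s' hs' => h s' hs'.1 hs'.2.2.2
  · exact ⟨(Frame.refl _ _).write (by decide) _ _ _, by simp [hpos], by simp [Memory.write],
      by simp⟩
  · rintro i s' ⟨hF, -, h2, -⟩
    exact ⟨h2, by rw [eval_var, hF 0 (by decide), hn]⟩
  · rintro i s' hi ⟨hF, h2, h3, h4⟩
    refine (Runs.forLoop (N := n) (B := 5 * k + 5)
      (fun j s'' => Frame {4, 5, 6, 14, 15, 16} s.mem s''.mem ∧ s''.pos = (i * n + j) * k ∧
        s''.mem 4 0 0 = i ∧ s''.mem 5 0 0 = j ∧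
        (∀ i' < i, ∀ j' < n, s''.mem 16 i' j' = keepCell ω (s.mem 1) n k i' j') ∧
        ∀ j' < j, s''.mem 16 i j' = keepCell ω (s.mem 1) n k i j') ?_ ?_ ?_).mono le_rfl ?_
    · refine ⟨hF.write (by decide) _ _ _, by simp [h2], ?_, by simp [Memory.write], ?_, by simp⟩
      · simp [Memory.write, h3]
      · intro i' hi' j' hj'
        rw [← h4 i' hi' j' hj']
        simp [Memory.write]
    · rintro j s'' ⟨hF', -, -, h5, -⟩
      exact ⟨h5, by rw [eval_var, hF' 0 (by decide), hn]⟩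
    · rintro j s'' hj ⟨hF', h5, h6, h7, h8, h9⟩
      refine runs_keep (n := n) h6 h7 (by rw [hF' 12 (by decide), hk]) h5 fun s₃ hF₃ hp₃ hm₃ => ?_
      rw [hF' 1 (by decide)] at hm₃
      refine ⟨by rw [hF₃ 5 (by decide), h7],
        (hF'.trans (hF₃.mono (by decide))).write (by decide) _ _ _, hp₃, ?_,
        by simp [Memory.write], ?_, ?_⟩
      · dsimp only
        rw [Memory.write_of_ne _ _ _ _ (by decide), hF₃ 4 (by decide), h6]
      · intro i' hi' j' hj'
        dsimp only
        rw [Memory.write_of_ne _ _ _ _ (by decide), hm₃, Memory.write_apply, if_neg (by omega)]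
        exact h8 i' hi' j' hj'
      · intro j' hj'
        dsimp only
        rw [Memory.write_of_ne _ _ _ _ (by decide), hm₃, Memory.write_apply]
        by_cases e : j' = j
        · simp [e]
        · rw [if_neg (by omega)]
          exact h9 j' (by omega)
    · rintro s'' ⟨hF', h5, h6, h7, h8, h9⟩
      refine ⟨h6, hF'.write (by decide) _ _ _, ?_, by simp [Memory.write], ?_⟩
      · simp only [h5]; ring
      · intro i' hi' j' hj'
        dsimp only
        rw [Memory.write_of_ne _ _ _ _ (by decide)]
        rcases Nat.lt_succ_iff_lt_or_eq.1 hi' with h | h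
        · exact h8 i' h j' hj'
        · rw [h]; exact h9 j' hj'

theorem runs_scaledDegreeProg {P : ℕ} (hn : s.mem 0 0 0 = n) (hP : s.mem 13 0 0 = P)
    (h : ∀ s', Frame {4, 5, 17} s.mem s'.mem →
      (∀ i < n, s'.mem 17 i 0 =
        ∑ j ∈ range n, if s.mem 16 i j + s.mem 16 j i = 0 then 0 else P) → Q s') :
    Runs ω scaledDegreeProg s (n * (1 + (n * (2 + 2) + 2) + 2) + 2) Q := by
  set f : ℕ → ℕ → ℕ := fun i j => if s.mem 16 i j + s.mem 16 j i = 0 then 0 else P with hf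
  refine (Runs.forLoop (N := n) (B := 1 + (n * (2 + 2) + 2))
    (fun i s' => Frame {4, 5, 17} s.mem s'.mem ∧ s'.mem 4 0 0 = i ∧
      ∀ i' < i, s'.mem 17 i' 0 = ∑ j ∈ range n, f i' j) ?_ ?_ ?_).mono le_rfl
    fun s' hs' => h s' hs'.1 hs'.2.2
  · exact ⟨(Frame.refl _ _).write (by decide) _ _ _, by simp [Memory.write], by simp⟩
  · rintro i s' ⟨hF, h2, -⟩
    exact ⟨h2, by rw [eval_var, hF 0 (by decide), hn]⟩
  · rintro i s' hi ⟨hF, h3, h4⟩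
    refine Runs.seq (Runs.assign ((Runs.forLoop (N := n) (B := 2)
      (fun j s'' => Frame {4, 5, 17} s.mem s''.mem ∧ s''.mem 4 0 0 = i ∧ s''.mem 5 0 0 = j ∧
        (∀ i' < i, s''.mem 17 i' 0 = ∑ j' ∈ range n, f i' j') ∧
        s''.mem 17 i 0 = ∑ j' ∈ range j, f i j') ?_ ?_ ?_).mono le_rfl ?_))
    · refine ⟨(hF.write (by decide) _ _ _).write (by decide) _ _ _, ?_, by simp [Memory.write], ?_,
        ?_⟩
      · simp [Memory.write, h3]
      · intro i' hi'
        rw [← h4 i' hi']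
        simp [Memory.write, h3, hi'.ne]
      · simp [Memory.write, h3]
    · rintro j s'' ⟨hF', -, h5, -⟩
      exact ⟨h5, by rw [eval_var, hF' 0 (by decide), hn]⟩
    · rintro j s'' hj ⟨hF', h6, h7, h8, h9⟩
      have hcond : isSampled.eval s''.mem = s.mem 16 i j + s.mem 16 j i := by
        simp only [isSampled, eval_add, eval_read, eval_var, h6, h7, hF' 16 (by decide)]
      refine Runs.ite (fun hc => Runs.assign ?_) (fun hc => Runs.skip ?_)
      · refine ⟨by simp [Memory.write, h7], (hF'.write (by decide) _ _ _).write (by decide) _ _ _,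
          by simp [Memory.write, h6], by simp [Memory.write], ?_, ?_⟩
        · intro i' hi'
          rw [← h8 i' hi']
          simp [Memory.write, h6, hi'.ne]
        · rw [sum_range_succ, ← h9]
          rw [hcond] at hc
          have e : f i j = P := if_neg hc
          simp [Memory.write, h6, e, hF' 13 (by decide), hP]
      · refine ⟨h7, hF'.write (by decide) _ _ _, by simp [Memory.write, h6],
          by simp [Memory.write], ?_, ?_⟩
        · intro i' hi'
          rw [← h8 i' hi']
          simp [Memory.write]
        · rw [sum_range_succ, ← h9]
          rw [hcond] at hc
          have e : f i j = 0 := if_pos hc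
          simp [Memory.write, e]
    · rintro s'' ⟨hF', h6, h7, h8, h9⟩
      refine ⟨h6, hF'.write (by decide) _ _ _, by simp [Memory.write], ?_⟩
      intro i' hi'
      dsimp only
      rw [Memory.write_of_ne _ _ _ _ (by decide)]
      rcases Nat.lt_succ_iff_lt_or_eq.1 hi' with h | h
      · exact h8 i' h
      · rw [h]; exact h9

theorem runs_weightProg {P D : ℕ} (hn : s.mem 0 0 0 = n) (hP : s.mem 13 0 0 = P)
    (hD : s.mem 3 0 0 = D)
    (h : ∀ s', s'.mem 3 0 0 = D →
      (∀ i < n, ∀ j < n, s'.mem 2 i j = if s.mem 16 i j + s.mem 16 j i = 0 then 0 else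
        P * (3 * D - (s.mem 17 i 0 + s.mem 17 j 0))) → Q s') :
    Runs ω weightProg s (n * (n * (3 * P + 3 + 1 + 1 + 2) + 2 + 2) + 2) Q := by
  set f : ℕ → ℕ → ℕ := fun i j => if s.mem 16 i j + s.mem 16 j i = 0 then 0 else
    P * (3 * D - (s.mem 17 i 0 + s.mem 17 j 0)) with hf
  refine (Runs.forLoop (N := n) (B := n * (3 * P + 3 + 1 + 1 + 2) + 2)
    (fun i s' => Frame {2, 4, 5, 6, 14} s.mem s'.mem ∧ s'.mem 4 0 0 = i ∧
      ∀ i' < i, ∀ j' < n, s'.mem 2 i' j' = f i' j') ?_ ?_ ?_).mono le_rfl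
    fun s' hs' => h s' (by rw [hs'.1 3 (by decide), hD]) hs'.2.2
  · exact ⟨(Frame.refl _ _).write (by decide) _ _ _, by simp [Memory.write], by simp⟩
  · rintro i s' ⟨hF, h2, -⟩
    exact ⟨h2, by rw [eval_var, hF 0 (by decide), hn]⟩
  · rintro i s' hi ⟨hF, h3, h4⟩
    refine (Runs.forLoop (N := n) (B := 3 * P + 3 + 1 + 1)
      (fun j s'' => Frame {2, 4, 5, 6, 14} s.mem s''.mem ∧ s''.mem 4 0 0 = i ∧
        s''.mem 5 0 0 = j ∧ (∀ i' < i, ∀ j' < n, s''.mem 2 i' j' = f i' j') ∧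
        ∀ j' < j, s''.mem 2 i j' = f i j') ?_ ?_ ?_).mono le_rfl ?_
    · refine ⟨hF.write (by decide) _ _ _, by simp [Memory.write, h3], by simp [Memory.write], ?_,
        by simp⟩
      intro i' hi' j' hj'
      rw [← h4 i' hi' j' hj']
      simp [Memory.write]
    · rintro j s'' ⟨hF', -, h5, -⟩
      exact ⟨h5, by rw [eval_var, hF' 0 (by decide), hn]⟩
    · rintro j s'' hj ⟨hF', h6, h7, h8, h9⟩
      have hcond : isSampled.eval s''.mem = s.mem 16 i j + s.mem 16 j i := by
        simp only [isSampled, eval_add, eval_read, eval_var, h6, h7, hF' 16 (by decide)]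
      have fin : ∀ s₃ : State, Frame {6, 14} s''.mem s₃.mem →
          (⟨(s₃.mem.write 2 i j (f i j)), s₃.pos⟩ : State).mem 5 0 0 = j ∧
          (Frame {2, 4, 5, 6, 14} s.mem ((s₃.mem.write 2 i j (f i j)).write 5 0 0 (j + 1)) ∧
          (s₃.mem.write 2 i j (f i j)).write 5 0 0 (j + 1) 4 0 0 = i ∧
          (s₃.mem.write 2 i j (f i j)).write 5 0 0 (j + 1) 5 0 0 = j + 1 ∧
          (∀ i' < i, ∀ j' < n,
            (s₃.mem.write 2 i j (f i j)).write 5 0 0 (j + 1) 2 i' j' = f i' j') ∧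
          ∀ j' < j + 1, (s₃.mem.write 2 i j (f i j)).write 5 0 0 (j + 1) 2 i j' = f i j') := by
        intro s₃ hF₃
        refine ⟨?_, ((hF'.trans (hF₃.mono (by decide))).write (by decide) _ _ _).write
          (by decide) _ _ _, ?_, by simp [Memory.write], ?_, ?_⟩
        · dsimp only
          rw [Memory.write_of_ne _ _ _ _ (by decide), hF₃ 5 (by decide), h7]
        · rw [Memory.write_of_ne _ _ _ _ (by decide), Memory.write_of_ne _ _ _ _ (by decide),
            hF₃ 4 (by decide), h6]
        · intro i' hi' j' hj'
          rw [Memory.write_of_ne _ _ _ _ (by decide), Memory.write_apply, if_neg (by omega),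
            hF₃ 2 (by decide)]
          exact h8 i' hi' j' hj'
        · intro j' hj'
          rw [Memory.write_of_ne _ _ _ _ (by decide), Memory.write_apply]
          by_cases e : j' = j
          · simp [e]
          · rw [if_neg (by omega), hF₃ 2 (by decide)]
            exact h9 j' (by omega)
      refine Runs.ite (fun hc => ?_) (fun hc => ?_)
      · rw [hcond] at hc
        refine Runs.seq (T₁ := 3 * P + 3) (T₂ := 1) (Runs.mulProg (dst := 14) (cnt := 6)
          (by decide) (x := P)
          (y := 3 * D - (s.mem 17 i 0 + s.mem 17 j 0)) (fun m hm => ?_) (fun m hm => ?_)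
          fun s₃ hF₃ _ hv => Runs.assign ?_)
        · rw [eval_var, hm 13 (by decide), hF' 13 (by decide), hP]
        · simp only [eval_sub, eval_add, eval_read, eval_var, eval_const, hm 3 (by decide),
            hm 4 (by decide), hm 5 (by decide), hm 17 (by decide), h6, h7, hF' 3 (by decide),
            hF' 17 (by decide), hD]
          congr 1
          ring
        · have := fin s₃ (hF₃.mono (by decide))
          have e : f i j = P * (3 * D - (s.mem 17 i 0 + s.mem 17 j 0)) := if_neg hc
          rw [e, ← hv] at this
          simpa only [eval_var, hF₃ 4 (by decide), hF₃ 5 (by decide), h6, h7] using this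
      · rw [hcond] at hc
        refine Runs.of_le (T := 1) (Runs.assign ?_) (by omega)
        have := fin s'' (Frame.refl _ _)
        have e : f i j = 0 := if_pos hc
        rw [e] at this
        simpa only [eval_var, eval_const, h6, h7] using this
    · rintro s'' ⟨hF', h6, h7, h8, h9⟩
      refine ⟨h6, hF'.write (by decide) _ _ _, by simp [Memory.write], ?_⟩
      intro i' hi' j' hj'
      dsimp only
      rw [Memory.write_of_ne _ _ _ _ (by decide)]
      rcases Nat.lt_succ_iff_lt_or_eq.1 hi' with h | h
      · exact h8 i' h j' hj'
      · rw [h]; exact h9 j' hj'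

end Specifications

end ResSparse

namespace ResSparse

open Finset

/-! ### The program computes the weights of the sparsifier. -/

section Algorithm

variable {n : ℕ} (G : SimpleGraph (Fin n)) [DecidableRel G.Adj]

/-- The coins that decide about the pairs of vertices. -/
def pairCoins (n k : ℕ) (ω : ℕ → Bool) : Fin n × Fin n → Fin k → Bool :=
  fun e t => ω ((e.1 * n + e.2) * k + t)

theorem inputMemory_adj (p q : ℕ) (i j : Fin n) :
    inputMemory G p q 1 i j = if G.Adj i j then 1 else 0 := by
  simp [inputMemory]

theorem keepCell_inputMemory (ω : ℕ → Bool) (k p q : ℕ) (i j : Fin n) :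
    keepCell ω (inputMemory G p q 1) n k i j =
      half G (fun _ => true) (pairCoins n k ω) i j := by
  unfold keepCell half
  rw [inputMemory_adj]
  have h : (∀ t < k, ω ((i * n + j) * k + t) = true) ↔
      pairCoins n k ω (i, j) = fun _ => true := by
    constructor
    · intro h
      funext t
      exact h t t.2
    · intro h t ht
      exact congrFun h ⟨t, ht⟩
  simp only [h, Fin.val_fin_lt]
  by_cases h1 : j < i <;> by_cases h2 : G.Adj i j <;>
    by_cases h3 : pairCoins n k ω (i, j) = fun _ => true <;> simp [h1, h2, h3]

theorem sum_inputMemory_adj {D : ℕ} (hG : G.IsRegularOfDegree D) (hn : 0 < n) (p q : ℕ) :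
    ∑ j ∈ range n, inputMemory G p q 1 0 j = D := by
  rw [Finset.sum_range]
  have h := sum_adj_of_regular G hG ⟨0, hn⟩
  have h' : ∀ j : Fin n, inputMemory G p q 1 0 j = if G.Adj ⟨0, hn⟩ j then 1 else 0 :=
    fun j => inputMemory_adj G p q ⟨0, hn⟩ j
  simp only [h']
  exact_mod_cast h

/-- The running time of the algorithm. -/
def sparsifyTime (n k l D : ℕ) : ℕ :=
  (3 * n + 3) + ((3 * l + 3) + ((3 * l + 3) + ((3 * (l * l) + 3) + ((3 * D + 3) + ((4 * k + 3) +
    ((n * (n * (5 * k + 5 + 2) + 2 + 2) + 2) + ((n * (1 + (n * (2 + 2) + 2) + 2) + 2) +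
      (n * (n * (3 * 2 ^ k + 3 + 1 + 1 + 2) + 2 + 2) + 2))))))))

/-- Multiplication by `2 ^ k` is done in unary for every pair, so `2 ^ k ≤ n` is what keeps the time
cubic. The numbers `p` and `q` enter only as summands. -/
theorem sparsifyTime_le {n k l D : ℕ} (hk : 2 ^ k ≤ n) (hl : l ≤ n) (hD : D ≤ n) :
    sparsifyTime n k l D ≤ 100 * (n + 1) ^ 3 := by
  have hk' : k ≤ n := Nat.lt_two_pow_self.le.trans hk
  calc sparsifyTime n k l D ≤ (3 * n + 3) + ((3 * n + 3) + ((3 * n + 3) + ((3 * (n * n) + 3) +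
      ((3 * n + 3) + ((4 * n + 3) + ((n * (n * (5 * n + 5 + 2) + 2 + 2) + 2) +
        ((n * (1 + (n * (2 + 2) + 2) + 2) + 2) +
          (n * (n * (3 * n + 3 + 1 + 1 + 2) + 2 + 2) + 2)))))))) := by
        unfold sparsifyTime
        gcongr
    _ ≤ _ := by
        ring_nf
        nlinarith [Nat.zero_le (n ^ 3), Nat.zero_le (n ^ 2)]

/-- For every coin sequence the output is exactly the integer weight matrix of the probabilistic
construction with denominator `D`. The two inequalities pin down the rate that the machine computes.
-/
theorem runs_sparsifyProg {D k p q : ℕ} (ω : ℕ → Bool) (hG : G.IsRegularOfDegree D) (hn : 0 < n)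
    (hk : 2 ^ k * (Nat.size n * Nat.size n * q) ≤ D * p)
    (hk' : D * p < 2 ^ (k + 1) * (Nat.size n * Nat.size n * q)) :
    Runs ω sparsifyProg ⟨inputMemory G p q, 0⟩ (sparsifyTime n k (Nat.size n) D) fun s =>
      s.mem 3 0 0 = D ∧ ∀ i j : Fin n, s.mem 2 i j =
        weightNum G (fun _ => true) D (pairCoins n k ω) i j := by
  set m := inputMemory G p q with hm
  have m0 : m 0 0 0 = n := by simp [hm, inputMemory]
  have m1 : m 0 0 1 = p := by simp [hm, inputMemory]
  have m2 : m 0 0 2 = q := by simp [hm, inputMemory]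
  unfold sparsifyProg sparsifyTime
  refine Runs.seq (runs_degreeProg m0 fun s₁ F₁ p₁ v₁ => ?_)
  rw [hm, sum_inputMemory_adj G hG hn] at v₁
  have g₁ : s₁.mem 0 = m 0 := F₁ 0 (by decide)
  refine Runs.seq (runs_sizeProg (by rw [g₁, m0]) fun s₂ F₂ p₂ v₂ => ?_)
  have g₂ : s₂.mem 0 = m 0 := (F₂ 0 (by decide)).trans g₁
  refine Runs.seq (Runs.mulProg (dst := 9) (cnt := 6) (by decide) (x := Nat.size n)
    (y := Nat.size n)
    (fun m' h => by rw [eval_var, h 7 (by decide), v₂])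
    (fun m' h => by rw [eval_var, h 7 (by decide), v₂]) fun s₃ F₃ p₃ v₃ => ?_)
  have g₃ : s₃.mem 0 = m 0 := (F₃ 0 (by decide)).trans g₂
  refine Runs.seq (Runs.mulProg (dst := 10) (cnt := 6) (by decide)
    (x := Nat.size n * Nat.size n) (y := q)
    (fun m' h => by rw [eval_var, h 9 (by decide), v₃])
    (fun m' h => by
      rw [eval_read, eval_const, eval_const, h 0 (by decide), g₃, m2]) fun s₄ F₄ p₄ v₄ => ?_)
  have g₄ : s₄.mem 0 = m 0 := (F₄ 0 (by decide)).trans g₃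
  have d₄ : s₄.mem 3 0 0 = D := by
    rw [F₄ 3 (by decide), F₃ 3 (by decide), F₂ 3 (by decide), v₁]
  refine Runs.seq (Runs.mulProg (dst := 11) (cnt := 6) (by decide) (x := D) (y := p)
    (fun m' h => by rw [eval_var, h 3 (by decide), d₄])
    (fun m' h => by
      rw [eval_read, eval_const, eval_const, h 0 (by decide), g₄, m1]) fun s₅ F₅ p₅ v₅ => ?_)
  have g₅ : s₅.mem 0 = m 0 := (F₅ 0 (by decide)).trans g₄
  refine Runs.seq (runs_rateProg (a := Nat.size n * Nat.size n * q) (b := D * p)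
    (by rw [F₅ 10 (by decide), v₄]) v₅ hk hk' fun s₆ F₆ p₆ v₆ v₆' => ?_)
  have g₆ : s₆.mem 0 = m 0 := (F₆ 0 (by decide)).trans g₅
  have a₆ : s₆.mem 1 = m 1 := by
    rw [F₆ 1 (by decide), F₅ 1 (by decide), F₄ 1 (by decide), F₃ 1 (by decide), F₂ 1 (by decide),
      F₁ 1 (by decide)]
  have d₆ : s₆.mem 3 0 0 = D := by rw [F₆ 3 (by decide), F₅ 3 (by decide), d₄]
  refine Runs.seq (runs_sampleProg (n := n) (by rw [g₆, m0]) v₆ (by rw [p₆, p₅, p₄, p₃, p₂, p₁])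
    fun s₇ F₇ v₇ => ?_)
  have g₇ : s₇.mem 0 = m 0 := (F₇ 0 (by decide)).trans g₆
  have h₇ : ∀ i j : Fin n, s₇.mem 16 i j + s₇.mem 16 j i =
      sample G (fun _ => true) (pairCoins n k ω) i j := by
    intro i j
    rw [v₇ i i.2 j j.2, v₇ j j.2 i i.2, a₆, hm, keepCell_inputMemory, keepCell_inputMemory, sample]
  have P₇ : s₇.mem 13 0 0 = 2 ^ k := by rw [F₇ 13 (by decide), v₆']
  refine Runs.seq (runs_scaledDegreeProg (n := n) (by rw [g₇, m0]) P₇ fun s₈ F₈ v₈ => ?_)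
  have h₈ : ∀ i : Fin n, s₈.mem 17 i 0 =
      2 ^ k * sampleDeg G (fun _ => true) (pairCoins n k ω) i := by
    intro i
    rw [v₈ i i.2, Finset.sum_range, sampleDeg, mul_sum]
    refine sum_congr rfl fun j _ => ?_
    rw [h₇]
    have := sample_le_one G (fun _ => true) (pairCoins n k ω) i j
    interval_cases sample G (fun _ => true) (pairCoins n k ω) i j <;> simp
  refine runs_weightProg (n := n) (by rw [F₈ 0 (by decide), g₇, m0])
    (by rw [F₈ 13 (by decide), P₇]) (D := D)
    (by rw [F₈ 3 (by decide), F₇ 3 (by decide), d₆]) fun s₉ d₉ v₉ => ⟨d₉, fun i j => ?_⟩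
  rw [v₉ i i.2 j j.2, h₈, h₈, F₈ 16 (by decide), h₇, weightNum]
  have := sample_le_one G (fun _ => true) (pairCoins n k ω) i j
  have hcard : Fintype.card (Fin k → Bool) = 2 ^ k := by simp
  rw [hcard, mul_add]
  interval_cases sample G (fun _ => true) (pairCoins n k ω) i j <;> simp

end Algorithm

/-! ### Coins of the machine -/

theorem count_equiv {Ω Ω' : Type*} [Fintype Ω] [Fintype Ω'] (e : Ω ≃ Ω') (Q : Ω' → Prop) :
    count (fun c => Q (e c)) = count Q := by
  classical
  rw [count_eq_sum, count_eq_sum]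
  exact Equiv.sum_comp e fun c => if Q c then (1 : ℝ) else 0

theorem pairCoins_index_lt {n k : ℕ} (i j : Fin n) (t : Fin k) :
    (i * n + j) * k + t < n * n * k := by
  have h1 : (i : ℕ) * n + j + 1 ≤ n * n := by
    have : ((i : ℕ) + 1) * n ≤ n * n := Nat.mul_le_mul_right _ i.2
    have := j.2
    linarith
  have h2 : ((i : ℕ) * n + j + 1) * k ≤ n * n * k := Nat.mul_le_mul_right _ h1
  have := t.2
  linarith

/-- The index is a mixed-radix expansion with digits `i`, `j`, `t`. Distinct pairs therefore read
disjoint blocks of coins, which gives independence. -/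
theorem pairCoins_index_injective (n k : ℕ) :
    Function.Injective fun e : (Fin n × Fin n) × Fin k =>
      ((e.1.1 : ℕ) * n + e.1.2) * k + e.2 := by
  have key : ∀ {b x x' y y' : ℕ}, y < b → y' < b → x * b + y = x' * b + y' → x = x' ∧ y = y' := by
    intro b x x' y y' hy hy' h
    have hx : x = x' := by
      have e1 : (x * b + y) / b = x := by
        rw [mul_comm, Nat.mul_add_div (by omega), Nat.div_eq_of_lt hy, add_zero]
      have e2 : (x' * b + y') / b = x' := by
        rw [mul_comm, Nat.mul_add_div (by omega), Nat.div_eq_of_lt hy', add_zero]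
      rw [← e1, ← e2, h]
    subst hx
    exact ⟨rfl, by omega⟩
  rintro ⟨⟨i, j⟩, t⟩ ⟨⟨i', j'⟩, t'⟩ h
  obtain ⟨h1, h2⟩ := key t.2 t'.2 h
  obtain ⟨h3, h4⟩ := key j.2 j'.2 h1
  exact Prod.ext (Prod.ext (Fin.ext h3) (Fin.ext h4)) (Fin.ext h2)

/-- The coins read by the machine are uniformly distributed. -/
theorem le_count_pairCoins {n k T : ℕ} (hT : n * n * k ≤ T)
    (Q : (Fin n × Fin n → Fin k → Bool) → Prop)
    (hQ : 2 / 3 * (Fintype.card (Fin n × Fin n → Fin k → Bool) : ℝ) ≤ count Q) :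
    2 / 3 * (2 : ℝ) ^ T ≤
      count (fun r : Fin T → Bool => Q (pairCoins n k (extendCoins r))) := by
  have hlt : ∀ e : (Fin n × Fin n) × Fin k, ((e.1.1 : ℕ) * n + e.1.2) * k + e.2 < T :=
    fun e => (pairCoins_index_lt e.1.1 e.1.2 e.2).trans_le hT
  set e : (Fin n × Fin n) × Fin k → Fin T := fun e => ⟨_, hlt e⟩ with he
  have hinj : Function.Injective e := fun a b h =>
    pairCoins_index_injective n k (congrArg Fin.val h)
  have h := count_comp_injective e hinj
    (fun f => Q (Equiv.curry (Fin n × Fin n) (Fin k) Bool f))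
  rw [count_equiv (Equiv.curry (Fin n × Fin n) (Fin k) Bool) Q] at h
  have hr : ∀ r : Fin T → Bool, pairCoins n k (extendCoins r) =
      Equiv.curry (Fin n × Fin n) (Fin k) Bool (fun i => r (e i)) := by
    intro r
    funext a t
    simp only [pairCoins, extendCoins, Equiv.curry_apply, Function.curry, he]
    rw [dif_pos (hlt (a, t))]
  simp only [hr]
  set κ := Fintype.card ((Fin n × Fin n) × Fin k) with hκ
  have hcard : (Fintype.card (Fin n × Fin n → Fin k → Bool) : ℝ) = 2 ^ κ := by
    rw [← Fintype.card_congr (Equiv.curry (Fin n × Fin n) (Fin k) Bool)]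
    rw [Fintype.card_fun, Fintype.card_bool, ← hκ]
    push_cast
    rfl
  rw [hcard] at hQ
  rw [Fintype.card_fin] at h
  have hκ0 : (0 : ℝ) < 2 ^ κ := by positivity
  refine le_of_mul_le_mul_right ?_ hκ0
  rw [h]
  calc 2 / 3 * (2 : ℝ) ^ T * 2 ^ κ = 2 / 3 * 2 ^ κ * 2 ^ T := by ring
    _ ≤ _ := mul_le_mul_of_nonneg_right hQ (by positivity)

end ResSparse

namespace ResSparse

open Finset Filter

/-! ### Parameters -/

theorem expands_of_le_expansion {V : Type*} [Fintype V] [DecidableEq V] {G : WGraph V} {φ : ℝ}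
    (h : φ ≤ G.expansion) : G.Expands φ := by
  intro S hS hS'
  have h1 : G.expansion ≤ G.cut S / S.card :=
    ciInf_le (Set.finite_range _).bddBelow
      (⟨S, hS, hS'⟩ : {S : Finset V // 0 < S.card ∧ 2 * S.card ≤ Fintype.card V})
  rw [← le_div_iff₀ (by exact_mod_cast hS)]
  exact h.trans h1

/-- The bit length is the integer substitute for `log n` that the machine can compute. -/
theorem log_le_size {n : ℕ} (hn : 0 < n) : Real.log n ≤ Nat.size n := by
  have h : (n : ℝ) ≤ 2 ^ Nat.size n := by exact_mod_cast (Nat.lt_size_self n).le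
  have h1 := Real.log_le_log (by exact_mod_cast hn) h
  rw [Real.log_pow] at h1
  have h2 : Real.log 2 ≤ 1 := by linarith [Real.log_two_lt_d9]
  exact h1.trans (mul_le_of_le_one_right (Nat.cast_nonneg _) h2)

theorem size_le_two_mul_log {n : ℕ} (hn : 3 ≤ Real.log n) : (Nat.size n : ℝ) ≤ 2 * Real.log n := by
  rcases Nat.eq_zero_or_pos (Nat.size n) with h0 | h0
  · rw [h0]; simp; linarith
  have h : 2 ^ (Nat.size n - 1) ≤ n := Nat.lt_size.1 (by omega)
  have h' : (2 : ℝ) ^ (Nat.size n - 1) ≤ n := by exact_mod_cast h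
  have h1 := Real.log_le_log (by positivity) h'
  rw [Real.log_pow, Nat.cast_sub h0] at h1
  have h2 := Real.log_two_gt_d9
  have h3 : (0 : ℝ) ≤ (Nat.size n : ℝ) - (1 : ℕ) := by
    rw [sub_nonneg]; exact_mod_cast h0
  push_cast at h1 h3
  nlinarith

/-- The number of vertices is large in terms of `β` and `γ`. -/
structure IsLarge (β γ : ℝ) (n : ℕ) : Prop where
  two_le : 2 ≤ n
  -- `1440 = 2 * 8 * 90` gives `8 * 90 * l ≤ l² / 2`, and `128 / γ ≤ l` bounds the `γ` term by the
  -- other half.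
  le_log : 1440 ≤ Real.log n
  div_le_log : 128 / γ ≤ Real.log n
  -- Since `n ^ 0.01 = n / n ^ 0.99`, this ensures `l² ≤ D * ε` throughout the permitted range of
  -- `ε`.
  log_sq_le : 4 * Real.log n ^ 2 ≤ β * (n : ℝ) ^ (0.01 : ℝ)

theorem eventually_isLarge {β : ℝ} (hβ : 0 < β) (γ : ℝ) :
    ∃ n₀ : ℕ, ∀ n, n₀ ≤ n → IsLarge β γ n := by
  rw [← eventually_atTop]
  have hlog : Tendsto (fun n : ℕ => Real.log n) atTop atTop :=
    Real.tendsto_log_atTop.comp tendsto_natCast_atTop_atTop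
  have hlittle : ∀ᶠ n : ℕ in atTop, 4 * Real.log n ^ 2 ≤ β * (n : ℝ) ^ (0.01 : ℝ) := by
    have h := (isLittleO_log_rpow_rpow_atTop (s := 0.01) 2 (by norm_num)).bound
      (show 0 < β / 4 by positivity)
    filter_upwards [tendsto_natCast_atTop_atTop.eventually h] with n hn
    have h1 : (0 : ℝ) ≤ (n : ℝ) ^ (0.01 : ℝ) := Real.rpow_nonneg (Nat.cast_nonneg _) _
    rw [Real.norm_eq_abs, Real.norm_eq_abs, abs_of_nonneg h1, Real.rpow_two,
      abs_of_nonneg (sq_nonneg _)] at hn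
    linarith
  filter_upwards [eventually_ge_atTop 2, hlog.eventually_ge_atTop 1440,
    hlog.eventually_ge_atTop (128 / γ), hlittle] with n h1 h2 h3 h4
  exact ⟨h1, h2, h3, h4⟩

/-! ### Existence and the algorithmic statement. -/

section Main

variable {β γ ε : ℝ} {n D k : ℕ} {G : SimpleGraph (Fin n)} [DecidableRel G.Adj]

theorem natCast_le_of_regular (hG : G.IsRegularOfDegree D) (hn : 0 < n) : D ≤ n := by
  rw [← hG ⟨0, hn⟩]
  exact (G.degree_lt_card_verts _).le.trans (by simp)

/-- `D ≤ n` forces `β ≤ 1`, and the cut around a single vertex forces `γ ≤ 1`. Hence the exponent `3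
/ (β * γ ^ 2)` is at least `3`. -/
theorem mul_sq_le_one (hn : 2 ≤ n) (hβ : 0 < β) (hγ : 0 < γ) (hG : G.IsRegularOfDegree D)
    (hD : β * n ≤ D) (hexp : (WGraph.ofGraph G).Expands (γ * D)) : β * γ ^ 2 ≤ 1 := by
  have hn0 : (0 : ℝ) < n := by exact_mod_cast (by omega : 0 < n)
  have hD0 : (0 : ℝ) < D := lt_of_lt_of_le (by positivity) hD
  have hDn : (D : ℝ) ≤ n := by exact_mod_cast natCast_le_of_regular hG (by omega)
  have hβ1 : β ≤ 1 := by
    by_contra h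
    nlinarith
  have hγ1 : γ ≤ 1 := by
    have h := hexp {⟨0, by omega⟩} (by simp) (by simpa using hn)
    have hcut : (WGraph.ofGraph G).cut {⟨0, by omega⟩} ≤ D := by
      rw [← WGraph.ofGraph_wdeg G hG ⟨0, by omega⟩, WGraph.cut, sum_singleton]
      exact sum_le_sum_of_subset_of_nonneg (subset_univ _) fun v _ _ =>
        (WGraph.ofGraph G).nonneg _ _
    simp only [card_singleton, Nat.cast_one, mul_one] at h
    by_contra hcon
    nlinarith
  have hγ2 : γ ^ 2 ≤ 1 := pow_le_one₀ hγ.le hγ1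
  exact mul_le_one₀ hβ1 (sq_nonneg _) hγ2

/-- The random subgraph of the right density yields a sparsifier with probability at least
`2/3`. -/
theorem le_count_sparsifier (hn : IsLarge β γ n) (hβ : 0 < β) (hγ : 0 < γ)
    (hG : G.IsRegularOfDegree D) (hD : β * n ≤ D) (hexp : (WGraph.ofGraph G).Expands (γ * D))
    (hε : 0 < ε) (hε1 : ε ≤ 1) (hk : 2 ^ k * (Nat.size n : ℝ) ^ 2 ≤ D * ε)
    (hk' : D * ε < 2 ^ (k + 1) * (Nat.size n : ℝ) ^ 2) :
    2 / 3 * (Fintype.card (Fin n × Fin n → Fin k → Bool) : ℝ) ≤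
      count (fun c : Fin n × Fin n → Fin k → Bool =>
        (WGraph.ofGraph G).IsResistanceSparsifier (sparsifier G (fun _ => true) D c) ε ∧
        ((sparsifier G (fun _ => true) D c).numEdges : ℝ) ≤
          ε⁻¹ * n * Real.log n ^ (3 / (β * γ ^ 2))) := by
  have hn0 : (0 : ℝ) < n := by exact_mod_cast (by linarith [hn.two_le] : 0 < n)
  set l : ℝ := (Nat.size n : ℝ) with hl
  have hlog := hn.le_log
  have hll : Real.log n ≤ l := log_le_size (by linarith [hn.two_le])
  have hl2 : l ≤ 2 * Real.log n := size_le_two_mul_log (by linarith)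
  set d : ℝ := (D : ℝ) / 2 ^ k with hd
  have hcard : (D : ℝ) / Fintype.card (Fin k → Bool) = d := by simp [hd]
  -- The rate places `ε * d` between `l²` and `2 * l²`: the lower bound gives accuracy, the upper
  -- one sparsity.
  have hεd : l ^ 2 ≤ ε * d := by
    rw [hd, mul_div_assoc', le_div_iff₀ (by positivity)]
    linarith
  have hεd' : ε * d ≤ 2 * l ^ 2 := by
    rw [hd, mul_div_assoc', div_le_iff₀ (by positivity)]
    rw [pow_succ] at hk'
    linarith
  have hd0 : 0 ≤ d := by positivity
  have hl0 : 1440 ≤ l := hlog.trans hll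
  have hld : l ^ 2 ≤ d := hεd.trans (mul_le_of_le_one_left hd0 hε1)
  have hγl : 128 ≤ γ * l := by
    have := hn.div_le_log.trans hll
    rwa [div_le_iff₀ hγ, mul_comm] at this
  have h512 : 512 * l ≤ d := by nlinarith
  have hγd : 128 * l ≤ γ * d := by
    calc 128 * l ≤ γ * l * l := mul_le_mul_of_nonneg_right hγl (by linarith)
      _ = γ * l ^ 2 := by ring
      _ ≤ γ * d := mul_le_mul_of_nonneg_left hld hγ.le
  have hexp24 : 24 * n * Real.exp (-(4 * l)) ≤ 1 := by
    have h1 : (n : ℝ) ≤ Real.exp l := by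
      rw [← Real.log_le_iff_le_exp hn0]; exact hll
    have h2 : (24 : ℝ) ≤ Real.exp l := by linarith [Real.add_one_le_exp l]
    calc 24 * n * Real.exp (-(4 * l)) ≤ Real.exp l * Real.exp l * Real.exp (-(4 * l)) := by gcongr
      _ = Real.exp (-(2 * l)) := by rw [← Real.exp_add, ← Real.exp_add]; congr 1; ring
      _ ≤ 1 := Real.exp_le_one_iff.2 (by linarith)
  have hreg : 8 * (90 * l + 384 / γ ^ 2) ≤ ε * d := by
    have h1 : 384 / γ ^ 2 ≤ l ^ 2 / 16 := by
      rw [div_le_iff₀ (by positivity)]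
      nlinarith
    nlinarith
  refine (le_count_isGood G (fun _ => true) hG hcard hexp (by linarith) h512 hγd hexp24).trans
    (count_mono fun c hc => ⟨?_, ?_⟩)
  · exact hc.isResistanceSparsifier hG hcard hexp hγ (by linarith) h512 hε.le hε1 hreg
  · refine (hc.numEdges_le (by linarith) h512).trans ?_
    -- The edge count needs only `4 * l²`; the third power of the logarithm absorbs the constants.
    have hL : Real.log n ^ 3 ≤ Real.log n ^ (3 / (β * γ ^ 2)) := by
      rw [← Real.rpow_natCast]
      refine Real.rpow_le_rpow_of_exponent_le (by linarith) ?_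
      rw [le_div_iff₀ (by positivity)]
      have := mul_sq_le_one hn.two_le hβ hγ hG hD hexp
      push_cast
      linarith
    have h4 : 4 * l ^ 2 ≤ Real.log n ^ 3 := by
      have : l ^ 2 ≤ (2 * Real.log n) ^ 2 := pow_le_pow_left₀ (by linarith) hl2 2
      nlinarith [sq_nonneg (Real.log n)]
    calc 2 * n * d = ε⁻¹ * n * (2 * (ε * d)) := by field_simp
      _ ≤ ε⁻¹ * n * (4 * l ^ 2) := by
          refine mul_le_mul_of_nonneg_left (by linarith) (by positivity)
      _ ≤ _ := mul_le_mul_of_nonneg_left (h4.trans hL) (by positivity)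

/-- The lower bound on `ε` gives `D * ε / l² ≥ 1`, so a largest power of two below it exists. -/
theorem exists_rate (hn : IsLarge β γ n) (hD : β * n ≤ D) (hε : 1 / (n : ℝ) ^ (0.99 : ℝ) < ε) :
    ∃ k : ℕ, 2 ^ k * (Nat.size n : ℝ) ^ 2 ≤ D * ε ∧
      D * ε < 2 ^ (k + 1) * (Nat.size n : ℝ) ^ 2 := by
  have hn0 : (0 : ℝ) < n := by exact_mod_cast (by linarith [hn.two_le] : 0 < n)
  have hlog := hn.le_log
  have hll := log_le_size (n := n) (by linarith [hn.two_le])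
  have hl2 := size_le_two_mul_log (n := n) (by linarith)
  have hl0 : (0 : ℝ) < Nat.size n := by linarith
  have hp : (0 : ℝ) < (n : ℝ) ^ (0.99 : ℝ) := Real.rpow_pos_of_pos hn0 _
  have hsplit : (n : ℝ) = (n : ℝ) ^ (0.01 : ℝ) * (n : ℝ) ^ (0.99 : ℝ) := by
    rw [← Real.rpow_add hn0]; norm_num
  have h1 : (Nat.size n : ℝ) ^ 2 ≤ D * ε := by
    calc (Nat.size n : ℝ) ^ 2 ≤ (2 * Real.log n) ^ 2 := pow_le_pow_left₀ hl0.le hl2 2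
      _ = 4 * Real.log n ^ 2 := by ring
      _ ≤ β * (n : ℝ) ^ (0.01 : ℝ) := hn.log_sq_le
      _ = β * n * (1 / (n : ℝ) ^ (0.99 : ℝ)) := by
          rw [mul_one_div, eq_div_iff hp.ne', mul_assoc, ← hsplit]
      _ ≤ D * ε := mul_le_mul hD hε.le (by positivity) (Nat.cast_nonneg _)
  obtain ⟨k, hk, hk'⟩ := exists_nat_pow_near (x := D * ε / (Nat.size n : ℝ) ^ 2) (y := (2 : ℝ))
    (by rw [le_div_iff₀ (by positivity)]; linarith) (by norm_num)
  refine ⟨k, ?_, ?_⟩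
  · rwa [le_div_iff₀ (by positivity)] at hk
  · rwa [div_lt_iff₀ (by positivity)] at hk'

/-- Probabilistic method: an event of probability at least `2 / 3` is not empty. -/
theorem exists_resistanceSparsifier (hn : IsLarge β γ n) (hβ : 0 < β) (hγ : 0 < γ)
    (hG : G.IsRegularOfDegree D) (hD : β * n ≤ D) (hexp : (WGraph.ofGraph G).Expands (γ * D))
    (hε : 1 / (n : ℝ) ^ (0.99 : ℝ) < ε) (hε1 : ε ≤ 1) :
    ∃ H : WGraph (Fin n), (WGraph.ofGraph G).IsResistanceSparsifier H ε ∧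
      (H.numEdges : ℝ) ≤ ε⁻¹ * n * Real.log n ^ (3 / (β * γ ^ 2)) := by
  have hε0 : 0 < ε := lt_of_le_of_lt (by positivity) hε
  obtain ⟨k, hk, hk'⟩ := exists_rate hn hD hε
  have h := le_count_sparsifier hn hβ hγ hG hD hexp hε0 hε1 hk hk'
  by_contra hcon
  have h0 : count (fun c : Fin n × Fin n → Fin k → Bool =>
        (WGraph.ofGraph G).IsResistanceSparsifier (sparsifier G (fun _ => true) D c) ε ∧
        ((sparsifier G (fun _ => true) D c).numEdges : ℝ) ≤
          ε⁻¹ * n * Real.log n ^ (3 / (β * γ ^ 2))) = 0 := by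
    rw [count_eq_sum]
    exact sum_eq_zero fun c _ => if_neg fun h => hcon ⟨_, h⟩
  rw [h0] at h
  have hpos : (0 : ℝ) < Fintype.card (Fin n × Fin n → Fin k → Bool) := by
    exact_mod_cast Fintype.card_pos
  linarith

open Polynomial in
theorem solvesInTime_sparsifyProg (hn : IsLarge β γ n) (hβ : 0 < β) (hγ : 0 < γ)
    (hG : G.IsRegularOfDegree D) (hD : β * n ≤ D) (hexp : (WGraph.ofGraph G).Expands (γ * D))
    {p q : ℕ} (hq : 0 < q) (hε : 1 / (n : ℝ) ^ (0.99 : ℝ) < (p : ℝ) / q)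
    (hε1 : (p : ℝ) / q < 1) :
    SolvesInTime sparsifyProg (inputMemory G p q)
      ((100 * (X + 1) ^ 3 : Polynomial ℕ).eval (inputSize n p q)) fun m =>
        ∃ H : WGraph (Fin n), IsOutput m H ∧
          (WGraph.ofGraph G).IsResistanceSparsifier H ((p : ℝ) / q) ∧
          (H.numEdges : ℝ) ≤ ((p : ℝ) / q)⁻¹ * n * Real.log n ^ (3 / (β * γ ^ 2)) := by
  set ε : ℝ := (p : ℝ) / q with hεdef
  have hε0 : 0 < ε := lt_of_le_of_lt (by positivity) hε
  have hnpos : 0 < n := by linarith [hn.two_le]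
  have hn0 : (0 : ℝ) < n := by exact_mod_cast hnpos
  have hq0 : (0 : ℝ) < q := by exact_mod_cast hq
  obtain ⟨k, hk, hk'⟩ := exists_rate hn hD hε
  set l := Nat.size n with hl
  have hDn : D ≤ n := natCast_le_of_regular hG hnpos
  have hD0 : 0 < D := by
    have : (0 : ℝ) < D := lt_of_lt_of_le (by positivity) hD
    exact_mod_cast this
  have hDp : (D : ℝ) * ε * q = D * p := by rw [hεdef]; field_simp
  have hkN : 2 ^ k * (l * l * q) ≤ D * p := by
    have h1 := mul_le_mul_of_nonneg_right hk hq0.le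
    rw [hDp] at h1
    have : (2 : ℝ) ^ k * (l * l * q) ≤ D * p := by linarith
    exact_mod_cast this
  have hkN' : D * p < 2 ^ (k + 1) * (l * l * q) := by
    have h1 := mul_lt_mul_of_pos_right hk' hq0
    rw [hDp] at h1
    have : (D : ℝ) * p < 2 ^ (k + 1) * (l * l * q) := by linarith
    exact_mod_cast this
  have hlpos : 1 ≤ l := Nat.size_pos.2 hnpos
  -- `2 ^ k ≤ D * ε ≤ D ≤ n`, so loops of length `2 ^ k` stay polynomial.
  have h2k : 2 ^ k ≤ n := by
    have h1 : (2 : ℝ) ^ k ≤ 2 ^ k * (l : ℝ) ^ 2 :=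
      le_mul_of_one_le_right (by positivity) (one_le_pow₀ (by exact_mod_cast hlpos))
    have h2 : (D : ℝ) * ε ≤ D := mul_le_of_le_one_right (Nat.cast_nonneg _) hε1.le
    have h3 : (D : ℝ) ≤ n := by exact_mod_cast hDn
    have : (2 : ℝ) ^ k ≤ n := by linarith
    exact_mod_cast this
  have hkn : k ≤ n := Nat.lt_two_pow_self.le.trans h2k
  have hln : l ≤ n := Nat.size_le.2 Nat.lt_two_pow_self
  have hnN : n ≤ inputSize n p q := by
    unfold inputSize
    nlinarith
  set T := (100 * (X + 1) ^ 3 : Polynomial ℕ).eval (inputSize n p q) with hTdef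
  have hT : 100 * (n + 1) ^ 3 ≤ T := by
    have e : T = 100 * (inputSize n p q + 1) ^ 3 := by
      rw [hTdef]
      simp
    rw [e]
    gcongr
  have hrun : ∀ ω, Runs ω sparsifyProg ⟨inputMemory G p q, 0⟩ T fun s =>
      s.mem 3 0 0 = D ∧ ∀ i j : Fin n, s.mem 2 i j =
        weightNum G (fun _ => true) D (pairCoins n k ω) i j := fun ω =>
    (runs_sparsifyProg G ω hG hnpos hkN hkN').of_le ((sparsifyTime_le h2k hln hDn).trans hT)
  refine ⟨fun ω => ?_, ?_⟩
  · obtain ⟨t, ht, s, hs, -⟩ := hrun ω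
    exact ⟨t, ht, s, hs⟩
  · have hnk : n * n * k ≤ T := by
      refine le_trans ?_ hT
      calc n * n * k ≤ n * n * n := Nat.mul_le_mul_left _ hkn
        _ = 1 * n ^ 3 := by ring
        _ ≤ 100 * (n + 1) ^ 3 := by gcongr <;> omega
    refine (le_count_pairCoins hnk _
      (le_count_sparsifier hn hβ hγ hG hD hexp hε0 hε1.le hk hk')).trans
      (count_mono fun r hr => ?_)
    obtain ⟨t, -, s, hs, h3, h2⟩ := hrun (extendCoins r)
    refine ⟨t, s, hs, sparsifier G (fun _ => true) D (pairCoins n k (extendCoins r)),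
      ⟨by rw [h3]; exact hD0, fun i j => ?_⟩, hr⟩
    rw [h3, h2]
    rfl

end Main

end ResSparse

open ResSparse in
theorem mainTheorem1 :
    ∃ C : ℝ, 0 < C ∧ ∀ β γ : ℝ, 0 < β → 0 < γ →
      ∃ (n₀ : ℕ) (A : Prog) (P : Polynomial ℕ), ∀ n : ℕ, n₀ ≤ n →
        ∀ (G : SimpleGraph (Fin n)) [DecidableRel G.Adj] (D : ℕ),
          G.IsRegularOfDegree D → β * n ≤ D → γ * D ≤ (WGraph.ofGraph G).expansion →
          (∀ ε : ℝ, 1 / (n : ℝ) ^ (0.99 : ℝ) < ε → ε < 1 →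
            ∃ H : WGraph (Fin n), (WGraph.ofGraph G).IsResistanceSparsifier H ε ∧
              (H.numEdges : ℝ) ≤ ε⁻¹ * n * (Real.log n) ^ (C / (β * γ ^ 2))) ∧
          (∀ p q : ℕ, 0 < q →
            1 / (n : ℝ) ^ (0.99 : ℝ) < (p : ℝ) / q → (p : ℝ) / q < 1 →
            SolvesInTime A (inputMemory G p q) (P.eval (inputSize n p q)) fun m =>
              ∃ H : WGraph (Fin n), IsOutput m H ∧
                (WGraph.ofGraph G).IsResistanceSparsifier H ((p : ℝ) / q) ∧
                (H.numEdges : ℝ) ≤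
                  ((p : ℝ) / q)⁻¹ * n * (Real.log n) ^ (C / (β * γ ^ 2))) := by
  -- `C = 3` works because `log³ n` already dominates the edge factor. Program and polynomial do not
  -- depend on `β` and `γ`; only `n₀` does.
  refine ⟨3, by norm_num, fun β γ hβ hγ => ?_⟩
  obtain ⟨n₀, hn₀⟩ := eventually_isLarge hβ γ
  refine ⟨n₀, sparsifyProg, 100 * (Polynomial.X + 1) ^ 3, fun n hn G _ D hG hD hexp => ⟨?_, ?_⟩⟩
  · intro ε hε hε1
    exact exists_resistanceSparsifier (hn₀ n hn) hβ hγ hG hD (expands_of_le_expansion hexp) hε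
      hε1.le
  · intro p q hq hε hε1
    exact solvesInTime_sparsifyProg (hn₀ n hn) hβ hγ hG hD (expands_of_le_expansion hexp) hq hε
      hε1
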